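/- Let $A$ be a non-unital (complex) C*-algebra with standard unitization $uA=A\oplus\mathbb C1$, let $\mathfrak{sa}(\cdot)$ denote self-adjoint parts, and let $(A,L)$ be a Lipschitz pair, i.e. $L$ is a seminorm defined on a dense real subspace of $\mathfrak{sa}(uA)$ (put $L=\infty$ outside it) with $\{x\in\mathfrak{sa}(uA):L(x)=0\}=\mathbb R1$. States of $A$ (positive linear functionals of norm one) are extended to $uA$ by $\varphi(1)=1$, and to normal states of the enveloping von Neumann algebras. The extended Monge–Kantorovich metric on the state space $\mathscr S(A)$ is $$\mathsf{mk}_L(\varphi,\psi)=\sup\{|\varphi(a)-\psi(a)|:a\in\mathfrak{sa}(A),\ L(a)\le1\}.$$ An element $h\in A$ is strictly positive if $h\ge0$ and $\varphi(h)>0$ for all $\varphi\in\mathscr S(A)$; $C^*(h)$ is the C*-subalgebra of $A$ generated by $h$. Let $M$ be an Abelian C*-subalgebra of $A$ with Gel'fand spectrum $\sigma(M)$; for compact $K\subseteq\sigma(M)$ let $1_K\in M^{**}\subseteq A^{**}$ be its indicator function, and $\mathscr S(A|K)=\{\varphi\in\mathscr S(A):\varphi(1_K)=1\}$. A state is local if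 it belongs to some $\mathscr S(A|K)$. A set $\mathscr K\subseteq\mathscr S(A)$ is tame if, for some local state $\mu$, $$\lim_K\ \sup\{|\varphi(x-1_Kx1_K)|:\varphi\in\mathscr K,\ x\in\mathfrak{sa}(uA),\ L(x)\le1,\ \mu(x)=0\}=0,$$ the limit being over the compact subsets $K$ of $\sigma(M)$ directed by inclusion. The triple $(A,L,M)$ is a quantum locally compact metric space if $M$ contains an approximate identity of $A$, each $\mathscr S(A|K)$ ($K\subseteq\sigma(M)$ compact) has finite $\mathsf{mk}_L$-diameter, and on every tame set of states the topology of $\mathsf{mk}_L$ is the weak* topology; it is a quantum locally compact separable metric space if moreover $A$ is separable. **Theorem.** The following are equivalent: 1. the set $\mathfrak L=\{a\in\mathfrak{sa}(A):L(a)\le1\}$ is norm bounded, and there exists a strictly positive $h\in A$ such that $h\mathfrak Lh=\{hah:a\in\mathfrak L\}$ is norm totally bounded; 2. there exists a strictly positive $h\in A$ such that $(A,L,C^*(h))$ is a quantum locally compact separable metric space and $\mathscr S(A)$ has finite diameter for $\mathsf{mk}_L$. -/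

import Mathlib

open scoped ComplexOrder ENNReal Topology

noncomputable section

namespace QuantumMetric

open Filter TopologicalSpace Unitization

/-! ### States, strictly positive elements, the unitization -/

section States

variable (A : Type*) [NonUnitalCStarAlgebra A] [PartialOrder A]

/-- The state space of `A`: positive linear functionals of norm one. Being a subtype of
`WeakDual ℂ A`, it carries the weak* topology. -/
def StateSpace : Type _ :=
  {φ : WeakDual ℂ A // (∀ a : A, 0 ≤ a → 0 ≤ φ a) ∧ ‖WeakDual.toStrongDual φ‖ = 1}

/-- The (relative) weak* topology on the state space. -/
instance StateSpace.instTopologicalSpace : TopologicalSpace (StateSpace A) :=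
  instTopologicalSpaceSubtype

variable {A}

/-- The value of a state at an element of `A`. -/
def StateSpace.eval (φ : StateSpace A) (a : A) : ℂ := φ.1 a

/-- The canonical extension `λ + a ↦ λ + φ a` of a state of a (non-unital) C*-algebra `A` to its
unitization, as a continuous linear functional. -/
def StateSpace.extend (φ : StateSpace A) : StrongDual ℂ (Unitization ℂ A) :=
  { toFun := fun x => x.fst + φ.1 x.snd
    map_add' := by intro x y; simp only [fst_add, snd_add, map_add]; ring
    map_smul' := by
      intro c x; simp only [fst_smul, snd_smul, map_smul, RingHom.id_apply, smul_add]
    cont := by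
      exact Unitization.continuous_fst.add
        ((WeakDual.toStrongDual φ.1).continuous.comp Unitization.continuous_snd) }

/-- `h` is a strictly positive element of `A`: it is positive and `φ h > 0` for every state. -/
def IsStrictlyPositiveElement (h : A) : Prop :=
  0 ≤ h ∧ ∀ φ : StateSpace A, 0 < φ.eval h

end States

/-- `A` has a (two-sided) multiplicative unit. -/
def IsUnitalAlgebra (A : Type*) [NonUnitalCStarAlgebra A] : Prop :=
  ∃ e : A, ∀ a : A, e * a = a ∧ a * e = a

/-! ### Lipschitz pairs and the Monge-Kantorovich metric -/

/-- A Lipschitz pair `(A, L)` for a non-unital C*-algebra `A`: a seminorm `L` defined on a dense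
real subspace `dom` of the self-adjoint part of the unitization of `A`, such that
`{x : L x = 0}` is the real line spanned by the unit. (Outside of `dom`, `L` is `∞`.) -/
structure LipschitzPair (A : Type*) [NonUnitalCStarAlgebra A] where
  /-- the domain of `L` -/
  dom : Submodule ℝ (selfAdjoint (Unitization ℂ A))
  /-- the Lipschitz seminorm -/
  L : Seminorm ℝ dom
  dense_dom : Dense (dom : Set (selfAdjoint (Unitization ℂ A)))
  L_eq_zero_iff : ∀ x : selfAdjoint (Unitization ℂ A),
    (∃ hx : x ∈ dom, L ⟨x, hx⟩ = 0) ↔ ∃ r : ℝ, x = r • (1 : selfAdjoint (Unitization ℂ A))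

section Lipschitz

variable {A : Type*} [NonUnitalCStarAlgebra A]

/-- The set `{a ∈ sa(A) : L a ≤ 1}`. -/
def LipschitzPair.lipBall (P : LipschitzPair A) : Set A :=
  {a | ∃ x : P.dom, ((x : selfAdjoint (Unitization ℂ A)) : Unitization ℂ A) = (a : Unitization ℂ A)
    ∧ P.L x ≤ 1}

variable [PartialOrder A]

/-- The set `{x ∈ sa(uA) : L x ≤ 1 and μ x = 0}` attached to a state `μ`, where `uA` is the
unitization of `A`. -/
def LipschitzPair.lipBallAt (P : LipschitzPair A) (μ : StateSpace A) : Set (Unitization ℂ A) :=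
  {y | ∃ x : P.dom, ((x : selfAdjoint (Unitization ℂ A)) : Unitization ℂ A) = y
    ∧ P.L x ≤ 1 ∧ μ.extend y = 0}

/-- The extended Monge-Kantorovich metric
`mk_L(φ, ψ) = sup {|φ a - ψ a| : a ∈ sa(A), L a ≤ 1}`. -/
def LipschitzPair.mkDist (P : LipschitzPair A) (φ ψ : StateSpace A) : ℝ≥0∞ :=
  ⨆ a ∈ P.lipBall, ‖φ.eval a - ψ.eval a‖ₑ

/-- The extended (pseudo)metric structure on the state space given by `mk_L`. -/
@[reducible]
def LipschitzPair.mkPseudoEMetricSpace (P : LipschitzPair A) :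
    PseudoEMetricSpace (StateSpace A) where
  edist := P.mkDist
  edist_self φ := by simp [LipschitzPair.mkDist]
  edist_comm φ ψ := by simp only [LipschitzPair.mkDist, enorm_sub_rev]
  edist_triangle φ ψ χ := by
    refine iSup₂_le fun a ha => ?_
    have h : φ.eval a - χ.eval a = (φ.eval a - ψ.eval a) + (ψ.eval a - χ.eval a) := by ring
    rw [h]
    exact (enorm_add_le _ _).trans (add_le_add
      (le_iSup₂ (f := fun a (_ : a ∈ P.lipBall) => ‖φ.eval a - ψ.eval a‖ₑ) a ha)
      (le_iSup₂ (f := fun a (_ : a ∈ P.lipBall) => ‖ψ.eval a - χ.eval a‖ₑ) a ha))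

/-- The topology on the state space induced by `mk_L`. -/
@[reducible]
def LipschitzPair.mkTopology (P : LipschitzPair A) : TopologicalSpace (StateSpace A) :=
  P.mkPseudoEMetricSpace.toUniformSpace.toTopologicalSpace

/-- The diameter, for `mk_L`, of a set of states. -/
def LipschitzPair.mkDiam (P : LipschitzPair A) (S : Set (StateSpace A)) : ℝ≥0∞ :=
  ⨆ φ ∈ S, ⨆ ψ ∈ S, P.mkDist φ ψ

end Lipschitz

/-! ### The bidual and its product -/

section Bidual

/-- The bidual of a Banach space. -/
abbrev Bidual (B : Type*) [NormedAddCommGroup B] [NormedSpace ℂ B] : Type _ :=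
  StrongDual ℂ (StrongDual ℂ B)

variable {B : Type*} [NonUnitalNormedRing B] [NormedSpace ℂ B] [IsScalarTower ℂ B B]
  [SMulCommClass ℂ B B]

/-- The (first Arens) product of the bidual: `(m □ n) ψ = m (a ↦ n (b ↦ ψ (a * b)))`. For a
C*-algebra `B` this is the product of its enveloping von Neumann algebra `B**`. -/
def Bidual.mul (m n : Bidual B) : Bidual B :=
  m ∘L (ContinuousLinearMap.compL ℂ B (StrongDual ℂ B) ℂ n) ∘L
    ((ContinuousLinearMap.compL ℂ B (B →L[ℂ] B) (StrongDual ℂ B)).flip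
      (ContinuousLinearMap.mul ℂ B)) ∘L (ContinuousLinearMap.compL ℂ B B ℂ)

theorem Bidual.mul_apply (m n : Bidual B) (ψ : StrongDual ℂ B) :
    Bidual.mul m n ψ =
      m (n ∘L (ContinuousLinearMap.compL ℂ B B ℂ ψ) ∘L ContinuousLinearMap.mul ℂ B) := rfl

end Bidual

/-! ### Topographies, indicators of compact sets, local states -/

section Topography

variable {A : Type*} [NonUnitalCStarAlgebra A]

/-- The Gel'fand spectrum `σ(M)` of a C*-subalgebra `M`, with its weak* topology. -/
abbrev Spec (M : NonUnitalStarSubalgebra ℂ A) : Type _ := WeakDual.characterSpace ℂ M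

variable [PartialOrder A]

/-- `(A, M)` is a topographic quantum space: `M` is an Abelian C*-subalgebra of `A` which contains
an approximate identity of `A`. -/
structure IsTopography (M : NonUnitalStarSubalgebra ℂ A) : Prop where
  isClosed : IsClosed (M : Set A)
  comm : ∀ a ∈ M, ∀ b ∈ M, a * b = b * a
  approx : ∃ l : Filter A, l.IsIncreasingApproximateUnit ∧ ∀ᶠ e in l, e ∈ M

/-- The elements of `M` which, seen as functions on the spectrum of `M`, take values in `[0, 1]`
and are equal to `1` on `K`. They are ordered by the order of `A`. -/
abbrev Majorant (M : NonUnitalStarSubalgebra ℂ A) (K : Compacts (Spec M)) : Type _ :=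
  {f : M // 0 ≤ (f : A) ∧ ‖f‖ ≤ 1 ∧ ∀ χ ∈ K, χ f = 1}

/-- An element of `M ⊆ A ⊆ uA`, seen in the bidual `(uA)**` with its weak* topology. -/
def Majorant.toBidual {M : NonUnitalStarSubalgebra ℂ A} {K : Compacts (Spec M)}
    (f : Majorant M K) : WeakDual ℂ (StrongDual ℂ (Unitization ℂ A)) :=
  StrongDual.toWeakDual
    (NormedSpace.inclusionInDoubleDual ℂ (Unitization ℂ A) ((f.1 : A) : Unitization ℂ A))

/-- The indicator function `1_K` of a compact subset `K` of the spectrum of `M`, as an element of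
`M** ⊆ A** ⊆ (uA)**`: as `K` is compact, it is the infimum, i.e. the weak* limit, of the decreasing
net of all `f ∈ M` with `1_K ≤ f ≤ 1` (this limit exists, see `tendsto_indicator`). Its value at a
functional `φ` is the measure of `K` for the Radon measure representing the restriction of `φ`
to `M`. -/
def indicator (M : NonUnitalStarSubalgebra ℂ A) (K : Compacts (Spec M)) :
    Bidual (Unitization ℂ A) :=
  WeakDual.toStrongDual (limUnder atBot (fun f : Majorant M K => f.toBidual))

section Indicator

open scoped CStarAlgebra

variable [StarOrderedRing A]


theorem norm_le_of_neg_le_of_le {x y : A} (h1 : -y ≤ x) (h2 : x ≤ y) : ‖x‖ ≤ 3 * ‖y‖ := by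
  have h3 : 0 ≤ x + y := by simpa using add_le_add_left h1 y
  have h4 : x + y ≤ y + y := by simpa using add_le_add_left h2 y
  have h5 := CStarAlgebra.norm_le_norm_of_nonneg_of_le h3 h4
  have h6 : x = (x + y) - y := by abel
  have h7 := norm_sub_le (x + y) y
  have h8 := norm_add_le y y
  rw [← h6] at h7
  linarith

theorem exists_small_variation {S : Set A} (hS : ∀ f ∈ S, 0 ≤ f ∧ ‖f‖ ≤ 1) (hne : S.Nonempty)
    (ψ : A →L[ℝ] ℝ) {ε : ℝ} (hε : 0 < ε) :
    ∃ f ∈ S, ∀ g ∈ S, g ≤ f → |ψ f - ψ g| < ε := by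
  by_contra! H
  obtain ⟨f₀, hf₀⟩ := hne
  have key : ∀ n : ℕ, ∃ g ∈ S, g ≤ f₀ ∧ ∃ x : A, -(f₀ - g) ≤ x ∧ x ≤ f₀ - g ∧ n * ε ≤ ψ x := by
    intro n
    induction n with
    | zero => exact ⟨f₀, hf₀, le_rfl, 0, by simp, by simp, by simp⟩
    | succ n ih =>
      obtain ⟨g, hg, hgf, x, hx1, hx2, hx3⟩ := ih
      obtain ⟨k, hk, hkg, hk2⟩ := H g hg
      have hd : 0 ≤ g - k := sub_nonneg.2 hkg
      have e1 : f₀ - k = (f₀ - g) + (g - k) := by abel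
      refine ⟨k, hk, hkg.trans hgf, ?_⟩
      rcases le_total 0 (ψ g - ψ k) with h | h
      · rw [abs_of_nonneg h] at hk2
        refine ⟨x + (g - k), ?_, ?_, ?_⟩
        · rw [e1, neg_add]
          exact add_le_add hx1 ((neg_nonpos.2 hd).trans hd)
        · rw [e1]; gcongr
        · rw [map_add, map_sub]; push_cast; linarith
      · rw [abs_of_nonpos h] at hk2
        refine ⟨x + -(g - k), ?_, ?_, ?_⟩
        · rw [e1, neg_add]; gcongr
        · rw [e1]; exact add_le_add hx2 ((neg_nonpos.2 hd).trans hd)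
        · rw [map_add, map_neg, map_sub]; push_cast; linarith
  obtain ⟨n, hn⟩ := exists_nat_gt ((‖ψ‖ * 3) / ε)
  obtain ⟨g, hg, hgf, x, hx1, hx2, hx3⟩ := key n
  have b1 := norm_le_of_neg_le_of_le hx1 hx2
  have b2 : ‖f₀ - g‖ ≤ 1 := (CStarAlgebra.norm_le_norm_of_nonneg_of_le (sub_nonneg.2 hgf)
    (sub_le_self _ (hS g hg).1)).trans (hS _ hf₀).2
  have b3 : ψ x ≤ ‖ψ‖ * 3 := (le_abs_self _).trans ((ψ.le_opNorm x).trans (by gcongr; linarith))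
  rw [div_lt_iff₀ hε] at hn
  linarith

theorem mul_le_left_of_commute {f g : A} (hf : 0 ≤ f) (hg : 0 ≤ g) (hg1 : ‖g‖ ≤ 1) (h : Commute f g) :
    f * g ≤ f := by
  rw [← sub_nonneg, ← Unitization.inr_nonneg_iff]
  have e : ((f - f * g : A) : Unitization ℂ A) = (f : Unitization ℂ A) * (1 - (g : Unitization ℂ A)) := by
    simp [mul_sub]
  rw [e]
  refine Commute.mul_nonneg (Unitization.inr_nonneg_iff.2 hf) ?_ ?_
  · rw [sub_nonneg]
    exact (CStarAlgebra.norm_le_one_iff_of_nonneg _ (Unitization.inr_nonneg_iff.2 hg)).1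
      (by rwa [Unitization.norm_inr])
  · refine Commute.sub_right (Commute.one_right _) ?_
    show _ * _ = _ * _
    rw [← Unitization.inr_mul, h.eq, Unitization.inr_mul]

/-- The net defining `indicator` is directed downwards. -/
theorem Majorant.directed (M : NonUnitalStarSubalgebra ℂ A) (K : Compacts (Spec M))
    (hM : ∀ a ∈ M, ∀ b ∈ M, a * b = b * a) (f g : Majorant M K) :
    ∃ k : Majorant M K, k ≤ f ∧ k ≤ g := by
  obtain ⟨f, hf0, hf1, hf⟩ := f
  obtain ⟨g, hg0, hg1, hg⟩ := g
  have hc : Commute (f : A) (g : A) := hM _ f.2 _ g.2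
  refine ⟨⟨f * g, hc.mul_nonneg hf0 hg0, (norm_mul_le _ _).trans (mul_le_one₀ hf1 (norm_nonneg _) hg1), ?_⟩, ?_, ?_⟩
  · intro χ hχ
    rw [map_mul, hf χ hχ, hg χ hχ, one_mul]
  · exact mul_le_left_of_commute hf0 hg0 hg1 hc
  · show ((f * g : M) : A) ≤ g
    have := mul_le_left_of_commute hg0 hf0 hf1 hc.symm
    rwa [← hc.eq] at this

theorem Majorant.exists_tendsto (M : NonUnitalStarSubalgebra ℂ A) (K : Compacts (Spec M))
    (hM : ∀ a ∈ M, ∀ b ∈ M, a * b = b * a) [Nonempty (Majorant M K)]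
    (ψ : A →L[ℂ] ℂ) :
    ∃ z : ℂ, Tendsto (fun f : Majorant M K => ψ (f.1 : A)) atBot (𝓝 z) := by
  have : IsDirected (Majorant M K) (· ≥ ·) := ⟨fun f g => Majorant.directed M K hM f g⟩
  apply CompleteSpace.complete
  rw [Metric.cauchy_iff]
  refine ⟨inferInstance, fun ε hε => ?_⟩
  set S : Set A := Set.range (fun f : Majorant M K => (f.1 : A)) with hSdef
  have hS : ∀ f ∈ S, 0 ≤ f ∧ ‖f‖ ≤ 1 := by
    rintro _ ⟨f, rfl⟩
    exact ⟨f.2.1, f.2.2.1⟩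
  obtain ⟨_, ⟨f₁, rfl⟩, h₁⟩ := exists_small_variation hS (Set.range_nonempty _)
    (Complex.reCLM ∘L ψ.restrictScalars ℝ) (ε := ε / 4) (by positivity)
  obtain ⟨_, ⟨f₂, rfl⟩, h₂⟩ := exists_small_variation hS (Set.range_nonempty _)
    (Complex.imCLM ∘L ψ.restrictScalars ℝ) (ε := ε / 4) (by positivity)
  obtain ⟨k, hk₁, hk₂⟩ := Majorant.directed M K hM f₁ f₂
  refine ⟨_, image_mem_map (Iic_mem_atBot k), ?_⟩
  rintro _ ⟨f, hf, rfl⟩ _ ⟨g, hg, rfl⟩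
  have a1 := h₁ f.1 ⟨f, rfl⟩ ((show f ≤ k from hf).trans hk₁)
  have a2 := h₁ g.1 ⟨g, rfl⟩ ((show g ≤ k from hg).trans hk₁)
  have a3 := h₂ f.1 ⟨f, rfl⟩ ((show f ≤ k from hf).trans hk₂)
  have a4 := h₂ g.1 ⟨g, rfl⟩ ((show g ≤ k from hg).trans hk₂)
  simp only [ContinuousLinearMap.comp_apply, ContinuousLinearMap.coe_restrictScalars',
    Complex.reCLM_apply, Complex.imCLM_apply, abs_lt] at a1 a2 a3 a4
  rw [dist_eq_norm]
  refine (Complex.norm_le_abs_re_add_abs_im _).trans_lt ?_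
  have b1 : |(ψ (f.1 : A) - ψ (g.1 : A)).re| < ε / 2 := by
    rw [Complex.sub_re, abs_lt]; constructor <;> linarith
  have b2 : |(ψ (f.1 : A) - ψ (g.1 : A)).im| < ε / 2 := by
    rw [Complex.sub_im, abs_lt]; constructor <;> linarith
  linarith

/-- For Abelian `M` the weak* limit defining `indicator M K` exists. -/
theorem tendsto_indicator (M : NonUnitalStarSubalgebra ℂ A)
    (K : Compacts (Spec M)) (hM : ∀ a ∈ M, ∀ b ∈ M, a * b = b * a) :
    Tendsto (fun f : Majorant M K => f.toBidual) atBot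
      (𝓝 (StrongDual.toWeakDual (indicator M K))) := by
  refine tendsto_nhds_limUnder ?_
  rcases isEmpty_or_nonempty (Majorant M K) with hE | hE
  · exact ⟨0, by rw [filter_eq_bot_of_isEmpty (atBot : Filter (Majorant M K))]; exact tendsto_bot⟩
  have : IsDirected (Majorant M K) (· ≥ ·) := ⟨fun f g => Majorant.directed M K hM f g⟩
  have hlim : ∀ ψ : StrongDual ℂ (Unitization ℂ A), ∃ z : ℂ,
      Tendsto (fun f : Majorant M K => ψ ((f.1 : A) : Unitization ℂ A)) atBot (𝓝 z) := fun ψ =>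
    Majorant.exists_tendsto M K hM (ψ ∘L
      ({ toLinearMap := Unitization.inrHom ℂ ℂ A, cont := Unitization.continuous_inr } :
        A →L[ℂ] Unitization ℂ A))
  choose z hz using hlim
  let ℓ : StrongDual ℂ (Unitization ℂ A) →ₗ[ℂ] ℂ :=
    linearMapOfTendsto (l := (atBot : Filter (Majorant M K))) z
      (fun f => (NormedSpace.inclusionInDoubleDual ℂ (Unitization ℂ A)
        ((f.1 : A) : Unitization ℂ A)).toLinearMap)
      (tendsto_pi_nhds.2 fun ψ => hz ψ)
  refine ⟨StrongDual.toWeakDual (ℓ.mkContinuous 1 fun ψ => ?_), ?_⟩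
  · refine le_of_tendsto (hz ψ).norm (Eventually.of_forall fun f => ?_)
    refine (ψ.le_opNorm _).trans ?_
    rw [Unitization.norm_inr, mul_comm]
    exact mul_le_mul_of_nonneg_right f.2.2.1 (norm_nonneg _)
  · rw [tendsto_iff_forall_eval_tendsto_topDualPairing]
    exact fun ψ => hz ψ

end Indicator

/-- The element `1_K x 1_K` of the bidual, for `x` in the unitization `uA`. -/
def corner (M : NonUnitalStarSubalgebra ℂ A) (K : Compacts (Spec M)) (x : Unitization ℂ A) :
    Bidual (Unitization ℂ A) :=
  Bidual.mul (Bidual.mul (indicator M K) (NormedSpace.inclusionInDoubleDual ℂ (Unitization ℂ A) x))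
    (indicator M K)

/-- The set `S(A|K)` of the states `φ` with `φ(1_K) = 1`. -/
def statesOn (M : NonUnitalStarSubalgebra ℂ A) (K : Compacts (Spec M)) : Set (StateSpace A) :=
  {φ | indicator M K φ.extend = 1}

/-- `μ` is a local state of `(A, M)`: it belongs to `S(A|K)` for some compact `K`. -/
def IsLocalState (M : NonUnitalStarSubalgebra ℂ A) (μ : StateSpace A) : Prop :=
  ∃ K : Compacts (Spec M), μ ∈ statesOn M K

/-! ### Quantum locally compact metric spaces -/

/-- The set `S` of states is tame: for some local state `μ`,
`sup {|φ (x - 1_K x 1_K)| : φ ∈ S, L x ≤ 1, μ x = 0}` tends to `0` along the compact subsets `K` of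
the spectrum of `M` directed by inclusion. -/
def IsTame (P : LipschitzPair A) (M : NonUnitalStarSubalgebra ℂ A) (S : Set (StateSpace A)) :
    Prop :=
  ∃ μ : StateSpace A, IsLocalState M μ ∧
    Tendsto (fun K : Compacts (Spec M) =>
      ⨆ x ∈ P.lipBallAt μ, ⨆ φ ∈ S, ‖φ.extend x - corner M K x φ.extend‖ₑ) atTop (𝓝 0)

/-- The triple `(A, L, M)` is regular: `S(A|K)` has finite diameter for every compact `K`. -/
def IsRegular (P : LipschitzPair A) (M : NonUnitalStarSubalgebra ℂ A) : Prop :=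
  ∀ K : Compacts (Spec M), P.mkDiam (statesOn M K) < ⊤

/-- `(A, L, M)` is a quantum locally compact metric space: a regular Lipschitz triple such that, on
every tame set of states, the topology of the metric `mk_L` is the weak* topology. -/
structure IsQuantumLocallyCompactMetricSpace (P : LipschitzPair A)
    (M : NonUnitalStarSubalgebra ℂ A) : Prop where
  topography : IsTopography M
  regular : IsRegular P M
  topology_eq : ∀ S : Set (StateSpace A), IsTame P M S →
    TopologicalSpace.induced ((↑) : S → StateSpace A) P.mkTopology =
      TopologicalSpace.induced ((↑) : S → StateSpace A) (StateSpace.instTopologicalSpace A)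

/-- `(A, L, M)` is a quantum locally compact separable metric space. -/
def IsQuantumLocallyCompactSeparableMetricSpace (P : LipschitzPair A)
    (M : NonUnitalStarSubalgebra ℂ A) : Prop :=
  IsQuantumLocallyCompactMetricSpace P M ∧ SeparableSpace A

end Topography

end QuantumMetric

end

noncomputable section

namespace QuantumMetric

open Filter TopologicalSpace Unitization

/-! ### Functionals on unital C*-algebras -/

section Unital

variable {B : Type*} [CStarAlgebra B]

/-! The equivalence rests on two facts. By Cauchy–Schwarz, a state φ with φ(e) close to 1, where 0 ≤
e and ‖e‖ ≤ 1, satisfies φ(a) ≈ φ(eae) uniformly for a in bounded sets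
(`norm_eval_sub_eval_mul_mul_le`). And if h is strictly positive, continuous functions of h form an
approximate unit (`tendsto_mul_approxUnit`), so that hA is dense in A.

From 1 to 2: approximating e by hb turns total boundedness of h𝔏h into that of e*𝔏e for every e.
Near a state φ₀, with e chosen so that φ₀(e) ≈ 1, finitely many elements ebe therefore control φ −
φ₀ on all of 𝔏. Hence `mk_L` induces the weak* topology on the whole state space, not only on tame
sets (`mkTopology_eq`). The finite diameters come from the norm bound, and separability from density
of the span of h𝔏h.

From 2 to 1: as A has no unit, 0 is in the spectrum of h in an essential way, and each a has states
almost vanishing at it; the finite diameter then bounds ‖a‖ on 𝔏 (`isBounded_lipBall`). For total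
boundedness, replace h by e = (h − r)₊, which lives on the compact set K = {h ≥ r}. The set S(A|K)
is tame and weak* compact, hence has finite `mk_L`-nets, and so, up to a small error on S(A|K),
finitely many elements represent 𝔏. Since ω(e · e) is a multiple of a state on K for every state ω,
closeness on S(A|K) becomes norm closeness after compression by e (`norm_eval_conj_le_of_statesOn`).
-/

theorem exists_functional_norm_eq [Nontrivial B] {c : B} (hc : IsSelfAdjoint c) :
    ∃ f : StrongDual ℂ B, f 1 = 1 ∧ (∀ x, ‖f x‖ ≤ ‖x‖) ∧ ‖f c‖ = ‖c‖ := by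
  have : IsStarNormal c := hc.isStarNormal
  -- One of ±‖c‖ is in the spectrum of c, hence is the value at c of a character of the unital
  -- C*-algebra generated by c. Hahn–Banach extends this character.
  obtain ⟨χ, hχ⟩ : ∃ χ : WeakDual.characterSpace ℂ (StarAlgebra.elemental ℂ c),
      ‖χ ⟨c, StarAlgebra.elemental.self_mem ℂ c⟩‖ = ‖c‖ := by
    rcases CStarAlgebra.norm_or_neg_norm_mem_spectrum hc with h | h
    · obtain ⟨χ, hχ⟩ := (StarAlgebra.elemental.bijective_characterSpaceToSpectrum c).2
        ⟨(‖c‖ : ℝ), by simpa using spectrum.algebraMap_mem ℂ h⟩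
      refine ⟨χ, ?_⟩
      have := congrArg Subtype.val hχ
      rw [StarAlgebra.elemental.characterSpaceToSpectrum_coe] at this
      rw [this]; simp
    · obtain ⟨χ, hχ⟩ := (StarAlgebra.elemental.bijective_characterSpaceToSpectrum c).2
        ⟨((-‖c‖ : ℝ) : ℂ), by simpa using spectrum.algebraMap_mem ℂ h⟩
      refine ⟨χ, ?_⟩
      have := congrArg Subtype.val hχ
      rw [StarAlgebra.elemental.characterSpaceToSpectrum_coe] at this
      rw [this]; simp
  have hb : ∀ x, ‖χ x‖ ≤ 1 * ‖x‖ := fun x => by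
    simpa using AlgHom.norm_apply_le_self χ x
  let g : StrongDual ℂ (Subalgebra.toSubmodule (StarAlgebra.elemental ℂ c).toSubalgebra) :=
    LinearMap.mkContinuous
      { toFun := fun x => χ ⟨x.1, x.2⟩
        map_add' := fun x y => map_add χ ⟨x.1, x.2⟩ ⟨y.1, y.2⟩
        map_smul' := fun r x => map_smul χ r ⟨x.1, x.2⟩ } 1 fun x => hb ⟨x.1, x.2⟩
  obtain ⟨f, hf, hfn⟩ := exists_extension_norm_eq _ g
  have hg : ‖g‖ ≤ 1 := LinearMap.mkContinuous_norm_le _ zero_le_one _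
  refine ⟨f, ?_, fun x => ?_, ?_⟩
  · have := hf ⟨1, one_mem (StarAlgebra.elemental ℂ c)⟩
    rw [this]
    exact map_one χ
  · have := f.le_opNorm x
    rw [hfn] at this
    nlinarith [norm_nonneg x]
  · have := hf ⟨c, StarAlgebra.elemental.self_mem ℂ c⟩
    rw [this]
    exact hχ

/-- ‖a + it‖² is at most ‖a‖² + t², while |f(a + it)|² contains the cross term 2t Im f(a), which is
unbounded in t unless Im f(a) = 0. -/
theorem im_apply_eq_zero {f : StrongDual ℂ B} (h1 : f 1 = 1) (hf : ∀ x, ‖f x‖ ≤ ‖x‖) {a : B}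
    (ha : IsSelfAdjoint a) : (f a).im = 0 := by
  have key : ∀ t : ℝ, ((f a).im + t) ^ 2 ≤ ‖a‖ ^ 2 + t ^ 2 := fun t => by
    have e1 : f (a + (t * Complex.I) • (1 : B)) = f a + t * Complex.I := by simp [h1]
    have e2 : star (a + (t * Complex.I) • (1 : B)) * (a + (t * Complex.I) • (1 : B)) =
        a * a + ((t ^ 2 : ℝ) : ℂ) • (1 : B) := by
      have : (-(Complex.I * (t * (Complex.I * t))) : ℂ) = (t ^ 2 : ℝ) := by
        push_cast; linear_combination (-(t : ℂ) ^ 2) * Complex.I_sq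
      simp only [star_add, star_smul, star_one, ha.star_eq, mul_add, add_mul, smul_mul_assoc,
        mul_smul_comm, one_mul, mul_one]
      rw [← this, star_mul']
      simp only [Complex.star_def, Complex.conj_ofReal, Complex.conj_I]
      module
    have e3 : ‖a + (t * Complex.I) • (1 : B)‖ ^ 2 ≤ ‖a‖ ^ 2 + t ^ 2 := by
      rcases subsingleton_or_nontrivial B with h | h
      · rw [Subsingleton.elim (a + (t * Complex.I) • (1 : B)) 0]; simp; positivity
      rw [sq, ← CStarRing.norm_star_mul_self, e2]
      refine (norm_add_le _ _).trans (add_le_add ((norm_mul_le _ _).trans_eq (sq _).symm) ?_)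
      rw [norm_smul, norm_one, mul_one, Complex.norm_real, Real.norm_of_nonneg (sq_nonneg t)]
    have e4 := hf (a + (t * Complex.I) • (1 : B))
    have e5 : |(f a).im + t| ≤ ‖f (a + (t * Complex.I) • (1 : B))‖ := by
      rw [e1]
      simpa using Complex.abs_im_le_norm (f a + t * Complex.I)
    calc ((f a).im + t) ^ 2 = |(f a).im + t| ^ 2 := (sq_abs _).symm
      _ ≤ ‖a + (t * Complex.I) • (1 : B)‖ ^ 2 := by gcongr; exact e5.trans e4
      _ ≤ _ := e3
  by_contra hne
  have := key ((‖a‖ ^ 2 + 1) / (f a).im)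
  have e : (f a).im * ((‖a‖ ^ 2 + 1) / (f a).im) = ‖a‖ ^ 2 + 1 := by field_simp
  nlinarith [sq_nonneg (f a).im, sq_nonneg ‖a‖]

theorem apply_nonneg_of_norm_le [PartialOrder B] [StarOrderedRing B] {f : StrongDual ℂ B}
    (h1 : f 1 = 1) (hf : ∀ x, ‖f x‖ ≤ ‖x‖) {a : B} (ha : 0 ≤ a) : 0 ≤ f a := by
  rw [Complex.nonneg_iff]
  refine ⟨?_, (im_apply_eq_zero h1 hf ha.isSelfAdjoint).symm⟩
  -- Contractivity at ‖a‖ − a gives ‖a‖ − Re f(a) ≤ ‖a‖.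
  have h2 : ‖algebraMap ℝ B ‖a‖ - a‖ ≤ ‖a‖ := by
    rw [CStarAlgebra.norm_le_iff_le_algebraMap _ (norm_nonneg a)
      (sub_nonneg.2 (IsSelfAdjoint.le_algebraMap_norm_self ha.isSelfAdjoint))]
    exact sub_le_self _ ha
  have h3 : f (algebraMap ℝ B ‖a‖ - a) = ‖a‖ - f a := by
    rw [map_sub, Algebra.algebraMap_eq_smul_one, ← Complex.coe_smul, map_smul, h1]
    simp
  have h4 := (Complex.re_le_norm _).trans ((hf _).trans h2)
  rw [h3] at h4
  simpa using h4

end Unital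

/-! ### States -/

section States

variable {A : Type*} [NonUnitalCStarAlgebra A] [PartialOrder A]

open scoped CStarAlgebra InnerProductSpace

theorem cauchySchwarz [StarOrderedRing A] (f : A →ₚ[ℂ] ℂ) (x y : A) :
    ‖f (star x * y)‖ ^ 2 ≤ (f (star x * x)).re * (f (star y * y)).re := by
  have h := norm_inner_le_norm (𝕜 := ℂ) (f.toPreGNS x) (f.toPreGNS y)
  rw [PositiveLinearMap.preGNS_inner_def] at h
  have hx := f.preGNS_norm_sq (f.toPreGNS x)
  have hy := f.preGNS_norm_sq (f.toPreGNS y)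
  simp only [PositiveLinearMap.ofPreGNS_toPreGNS] at h hx hy
  rw [← hx, ← hy]
  norm_cast
  rw [← mul_pow]
  gcongr

namespace StateSpace

theorem continuous_eval (a : A) : Continuous fun φ : StateSpace A => φ.eval a :=
  (WeakDual.eval_continuous a).comp continuous_subtype_val

variable (φ : StateSpace A)

theorem eval_nonneg {a : A} (ha : 0 ≤ a) : 0 ≤ φ.eval a := φ.2.1 a ha

theorem norm_eval_le (a : A) : ‖φ.eval a‖ ≤ ‖a‖ := by
  simpa [φ.2.2, eval] using (WeakDual.toStrongDual φ.1).le_opNorm a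

theorem eval_add (a b : A) : φ.eval (a + b) = φ.eval a + φ.eval b := map_add φ.1 a b
theorem eval_sub (a b : A) : φ.eval (a - b) = φ.eval a - φ.eval b := map_sub φ.1 a b
theorem eval_smul (c : ℂ) (a : A) : φ.eval (c • a) = c * φ.eval a := map_smul φ.1 c a

theorem extend_apply (x : Unitization ℂ A) : φ.extend x = x.fst + φ.eval x.snd := rfl

theorem extend_inr (a : A) : φ.extend (a : Unitization ℂ A) = φ.eval a := by
  simp [extend_apply]

theorem extend_one : φ.extend 1 = 1 := by
  simp [extend_apply, eval]

variable [StarOrderedRing A]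

/-- A state as a positive linear map. -/
def toPositive : A →ₚ[ℂ] ℂ := .mk₀ (φ.1 : A →ₗ[ℂ] ℂ) φ.2.1

theorem toPositive_apply (a : A) : φ.toPositive a = φ.eval a := rfl

theorem eval_star (a : A) : φ.eval (star a) = star (φ.eval a) := map_star φ.toPositive a

/-- Cauchy–Schwarz against the unit, with an approximate unit standing in for it. -/
theorem norm_eval_sq_le (a : A) : ‖φ.eval a‖ ^ 2 ≤ (φ.eval (star a * a)).re := by
  have hl := CStarAlgebra.increasingApproximateUnit A
  have := hl.neBot
  have h1 : Tendsto (fun e : A => ‖φ.eval (star e * a)‖ ^ 2) (CStarAlgebra.approximateUnit A)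
      (𝓝 (‖φ.eval a‖ ^ 2)) := by
    refine Tendsto.pow (Tendsto.norm ?_) 2
    refine ((WeakDual.toStrongDual φ.1).continuous.tendsto a).comp ?_
    refine (hl.tendsto_mul_right a).congr' ?_
    filter_upwards [hl.eventually_star_eq] with e he
    rw [he]
  refine le_of_tendsto h1 ?_
  filter_upwards [hl.eventually_norm] with e he
  refine (cauchySchwarz φ.toPositive e a).trans ?_
  have h2 : 0 ≤ (φ.eval (star a * a)).re := (Complex.nonneg_iff.1 (φ.eval_nonneg (star_mul_self_nonneg a))).1
  refine mul_le_of_le_one_left h2 ?_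
  refine (Complex.re_le_norm _).trans ((φ.norm_eval_le _).trans ?_)
  rw [CStarRing.norm_star_mul_self]
  exact mul_le_one₀ he (norm_nonneg _) he

theorem extend_star_mul_self_nonneg (x : Unitization ℂ A) : 0 ≤ φ.extend (star x * x) := by
  set l := x.fst with hl
  set a := x.snd with ha
  have e : φ.extend (star x * x) =
      star l * l + star l * φ.eval a + star (star l * φ.eval a) + φ.eval (star a * a) := by
    rw [extend_apply, fst_mul, snd_mul, fst_star, snd_star, ← hl, ← ha, eval_add, eval_add,
      eval_smul, eval_smul, eval_star]
    simp
    ring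
  rw [e]
  have h1 := φ.norm_eval_sq_le a
  have h2 := Complex.nonneg_iff.1 (φ.eval_nonneg (star_mul_self_nonneg a))
  rw [← Complex.normSq_eq_norm_sq, Complex.normSq_apply] at h1
  rw [Complex.nonneg_iff]
  constructor
  · simp
    -- As φ(a*a) ≥ |φ(a)|², the value is at least |l + φ(a)|².
    nlinarith [sq_nonneg (l.re + (φ.eval a).re), sq_nonneg (l.im + (φ.eval a).im)]
  · simp [← h2.2]
    ring

/-- The extension of a state to the unitization, as a positive linear map. -/
def extendPositive : Unitization ℂ A →ₚ[ℂ] ℂ :=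
  .mk₀ (φ.extend : Unitization ℂ A →ₗ[ℂ] ℂ) fun x hx => by
    rw [CStarAlgebra.nonneg_iff_eq_star_mul_self] at hx
    obtain ⟨y, rfl⟩ := hx
    exact φ.extend_star_mul_self_nonneg y

theorem extendPositive_apply (x : Unitization ℂ A) : φ.extendPositive x = φ.extend x := rfl

/-- Cauchy–Schwarz combined with (1 − e)² ≤ 1 − e. When φ(e) = 1 the bound vanishes, so φ absorbs e
as a factor. -/
theorem norm_extend_mul_one_sub_sq_le (x : Unitization ℂ A) {e : A} (he : 0 ≤ e) (he1 : ‖e‖ ≤ 1) :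
    ‖φ.extend (x * (1 - e))‖ ^ 2 ≤ ‖x‖ ^ 2 * (1 - (φ.eval e).re) := by
  have he' : (0 : Unitization ℂ A) ≤ e := Unitization.inr_nonneg_iff.2 he
  have hd : (0 : Unitization ℂ A) ≤ 1 - e :=
    sub_nonneg.2 ((CStarAlgebra.norm_le_one_iff_of_nonneg _ he').1 (by rwa [Unitization.norm_inr]))
  have h := cauchySchwarz φ.extendPositive (star x) (1 - (e : Unitization ℂ A))
  rw [star_star, hd.star_eq] at h
  refine h.trans ?_
  have h0 : ∀ z : Unitization ℂ A, 0 ≤ z → 0 ≤ (φ.extendPositive z).re := fun z hz =>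
    (Complex.nonneg_iff.1 (φ.extendPositive.map_nonneg hz)).1
  have h2 : (1 - e : Unitization ℂ A) * (1 - e) ≤ 1 - e := by
    rw [← sub_nonneg]
    have : (1 - e : Unitization ℂ A) - (1 - e) * (1 - e) = e * (1 - e) := by noncomm_ring
    rw [this]
    exact Commute.mul_nonneg he' hd ((Commute.one_right _).sub_right (Commute.refl _))
  gcongr
  · exact h0 _ ((star_mul_self_nonneg (1 - (e : Unitization ℂ A))).trans_eq (by rw [hd.star_eq]))
  · have h3 := φ.extendPositive.norm_apply_le_of_nonneg (x * star x) (mul_star_self_nonneg x)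
    rw [CStarRing.norm_self_mul_star, extendPositive_apply φ 1, extend_one, norm_one, one_mul, ← sq]
      at h3
    exact (Complex.re_le_norm _).trans h3
  · have h3 := (Complex.le_def.1 (OrderHomClass.mono φ.extendPositive h2)).1
    refine h3.trans_eq ?_
    rw [extendPositive_apply, map_sub, extend_one, extend_inr]
    simp

theorem extend_star (x : Unitization ℂ A) : φ.extend (star x) = star (φ.extend x) :=
  map_star φ.extendPositive x

theorem norm_extend_one_sub_mul_sq_le (x : Unitization ℂ A) {e : A} (he : 0 ≤ e) (he1 : ‖e‖ ≤ 1) :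
    ‖φ.extend ((1 - e) * x)‖ ^ 2 ≤ ‖x‖ ^ 2 * (1 - (φ.eval e).re) := by
  have h := φ.norm_extend_mul_one_sub_sq_le (star x) he he1
  have e1 : star x * (1 - (e : Unitization ℂ A)) = star ((1 - e) * x) := by
    rw [star_mul, star_sub, star_one, ← Unitization.inr_star, he.star_eq]
  rwa [e1, extend_star, norm_star, norm_star] at h

theorem extend_mul_eq {e : A} (he : 0 ≤ e) (he1 : ‖e‖ ≤ 1) (h : φ.eval e = 1)
    (x : Unitization ℂ A) : φ.extend (x * e) = φ.extend x := by
  have := φ.norm_extend_mul_one_sub_sq_le x he he1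
  rw [h, Complex.one_re, sub_self, mul_zero] at this
  have := norm_eq_zero.1 (pow_eq_zero_iff two_ne_zero |>.1 (this.antisymm (sq_nonneg _)))
  rw [mul_sub, mul_one, map_sub, sub_eq_zero] at this
  exact this.symm

theorem extend_mul_eq' {e : A} (he : 0 ≤ e) (he1 : ‖e‖ ≤ 1) (h : φ.eval e = 1)
    (x : Unitization ℂ A) : φ.extend (e * x) = φ.extend x := by
  have := φ.norm_extend_one_sub_mul_sq_le x he he1
  rw [h, Complex.one_re, sub_self, mul_zero] at this
  have := norm_eq_zero.1 (pow_eq_zero_iff two_ne_zero |>.1 (this.antisymm (sq_nonneg _)))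
  rw [sub_mul, one_mul, map_sub, sub_eq_zero] at this
  exact this.symm

/-- Splits a − eae as (1 − e)a + ea(1 − e). The defect is written δ² because Cauchy–Schwarz bounds
squares. -/
theorem norm_eval_sub_eval_mul_mul_le (a : A) {e : A} (he : 0 ≤ e) (he1 : ‖e‖ ≤ 1) {δ : ℝ}
    (hδ : 0 ≤ δ) (h : 1 - δ ^ 2 ≤ (φ.eval e).re) :
    ‖φ.eval a - φ.eval (e * a * e)‖ ≤ 2 * ‖a‖ * δ := by
  have h1 := φ.norm_extend_one_sub_mul_sq_le a he he1
  have h2 := φ.norm_extend_mul_one_sub_sq_le ((e * a : A) : Unitization ℂ A) he he1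
  have h3 : ‖e * a‖ ≤ ‖a‖ := (norm_mul_le _ _).trans (mul_le_of_le_one_left (norm_nonneg _) he1)
  have h4 : φ.eval a - φ.eval (e * a * e) =
      φ.extend ((1 - e) * a) + φ.extend (((e * a : A) : Unitization ℂ A) * (1 - e)) := by
    rw [← map_add, ← extend_inr, ← extend_inr, ← map_sub]
    congr 1
    simp only [Unitization.inr_mul]
    noncomm_ring
  rw [Unitization.norm_inr] at h1 h2
  have h5 : ‖φ.extend ((1 - e) * a)‖ ≤ ‖a‖ * δ := by
    refine le_of_sq_le_sq (h1.trans ?_) (by positivity)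
    rw [mul_pow]; gcongr; linarith
  have h6 : ‖φ.extend (((e * a : A) : Unitization ℂ A) * (1 - e))‖ ≤ ‖a‖ * δ := by
    refine le_of_sq_le_sq (h2.trans ?_) (by positivity)
    rw [mul_pow]
    have : 1 - (φ.eval e).re ≤ δ ^ 2 := by linarith
    have h7 : 0 ≤ 1 - (φ.eval e).re :=
      sub_nonneg.2 ((Complex.re_le_norm _).trans ((φ.norm_eval_le e).trans he1))
    gcongr
  rw [h4]
  refine (norm_add_le _ _).trans ?_
  linarith

/-- A positive functional bounded by `1` which attains norm `1` is a state. -/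
def ofBound (f : StrongDual ℂ A) (hpos : ∀ a, 0 ≤ a → 0 ≤ f a) (hle : ∀ a, ‖f a‖ ≤ ‖a‖)
    (c : A) (hc : c ≠ 0) (hfc : ‖c‖ ≤ ‖f c‖) : StateSpace A :=
  ⟨StrongDual.toWeakDual f, hpos, by
    refine le_antisymm (f.opNorm_le_bound zero_le_one fun a => by simpa using hle a) ?_
    have := hfc.trans (f.le_opNorm c)
    exact one_le_of_le_mul_right₀ (norm_pos_iff.2 hc) this⟩

theorem exists_norm_eval_eq {c : A} (hc : IsSelfAdjoint c) (h0 : c ≠ 0) :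
    ∃ φ : StateSpace A, ‖φ.eval c‖ = ‖c‖ := by
  obtain ⟨f, hf1, hf, hfc⟩ := exists_functional_norm_eq (hc.inr ℂ)
  rw [Unitization.norm_inr] at hfc
  let g : StrongDual ℂ A := f ∘L
      ({ toLinearMap := Unitization.inrHom ℂ ℂ A, cont := Unitization.continuous_inr } :
        A →L[ℂ] Unitization ℂ A)
  refine ⟨ofBound g (fun a ha => ?_) (fun a => ?_) c h0 hfc.ge, hfc⟩
  · exact apply_nonneg_of_norm_le hf1 hf (Unitization.inr_nonneg_iff.2 ha)
  · exact (hf _).trans_eq (Unitization.norm_inr a)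

end StateSpace

end States

/-! ### Strictly positive elements -/

section StrictlyPositive

variable {A : Type*} [NonUnitalCStarAlgebra A]

open scoped CStarAlgebra

theorem real_cfcₙ_mem_elemental (g : ℝ → ℝ) {h : A} (hh : IsSelfAdjoint h) :
    cfcₙ g h ∈ NonUnitalStarAlgebra.elemental ℂ h := by
  rw [cfcₙ_real_eq_complex g hh]
  exact cfcₙ_mem_elemental _ _

/-- The element `n²h² (1 + n²h²)⁻¹`. -/
def approxUnit (h : A) (n : ℕ) : A :=
  cfcₙ (fun t : ℝ => t * (n ^ 2 * t / (1 + n ^ 2 * t ^ 2))) h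

/-- The element `n²h (1 + n²h²)⁻¹`. -/
def approxInv (h : A) (n : ℕ) : A :=
  cfcₙ (fun t : ℝ => n ^ 2 * t / (1 + n ^ 2 * t ^ 2)) h

theorem continuous_approxInv (n : ℕ) :
    Continuous (fun t : ℝ => n ^ 2 * t / (1 + n ^ 2 * t ^ 2)) :=
  Continuous.div (by fun_prop) (by fun_prop) fun t => by positivity

theorem approxUnit_eq_mul {h : A} (hh : IsSelfAdjoint h) (n : ℕ) :
    approxUnit h n = h * approxInv h n := by
  rw [approxUnit, cfcₙ_mul (fun t : ℝ => t) _ h (by fun_prop) rfl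
    (continuous_approxInv n).continuousOn (by simp), cfcₙ_id' ℝ h]
  rfl

theorem norm_approxUnit_le (h : A) (n : ℕ) : ‖approxUnit h n‖ ≤ 1 := by
  refine norm_cfcₙ_le fun t _ => ?_
  rw [← mul_div_assoc, Real.norm_of_nonneg, div_le_one (by positivity)]
  · nlinarith
  · rw [show t * (n ^ 2 * t) = n ^ 2 * t ^ 2 by ring]; positivity

theorem norm_sub_mul_approxUnit_le {h : A} (hh : IsSelfAdjoint h) {n : ℕ} (hn : 0 < n) :
    ‖h - h * approxUnit h n‖ ≤ 1 / n := by
  have hc : Continuous fun t : ℝ => t * (n ^ 2 * t / (1 + n ^ 2 * t ^ 2)) :=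
    continuous_id.mul (continuous_approxInv n)
  have e : h - h * approxUnit h n =
      cfcₙ (fun t : ℝ => t - t * (t * (n ^ 2 * t / (1 + n ^ 2 * t ^ 2)))) h := by
    rw [cfcₙ_sub (fun t : ℝ => t) (fun t => t * (t * (n ^ 2 * t / (1 + n ^ 2 * t ^ 2)))) h
      (by fun_prop) rfl (continuous_id.mul hc).continuousOn (by simp), cfcₙ_mul (fun t : ℝ => t) _ h (by fun_prop) rfl hc.continuousOn (by simp),
      cfcₙ_id' ℝ h]
    rfl
  rw [e]
  refine norm_cfcₙ_le fun t _ => ?_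
  have e2 : t - t * (t * (n ^ 2 * t / (1 + n ^ 2 * t ^ 2))) = t / (1 + n ^ 2 * t ^ 2) := by
    have : (1 + n ^ 2 * t ^ 2 : ℝ) ≠ 0 := by positivity
    field_simp
    ring
  have hn' : (0 : ℝ) < n := by exact_mod_cast hn
  rw [e2, norm_div, Real.norm_of_nonneg (by positivity : (0 : ℝ) ≤ 1 + n ^ 2 * t ^ 2),
    div_le_div_iff₀ (by positivity) hn', Real.norm_eq_abs]
  -- Expanding (n|t| − 1)² ≥ 0 gives 2n|t| ≤ 1 + n²t².
  nlinarith [sq_nonneg (n * |t| - 1), sq_abs t, abs_nonneg t]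

theorem approxUnit_mem_elemental {h : A} (hh : IsSelfAdjoint h) (n : ℕ) :
    approxUnit h n ∈ NonUnitalStarAlgebra.elemental ℂ h :=
  real_cfcₙ_mem_elemental _ hh

variable [PartialOrder A] [StarOrderedRing A]

theorem approxUnit_nonneg (h : A) (n : ℕ) : 0 ≤ approxUnit h n := by
  refine cfcₙ_nonneg fun t _ => ?_
  rw [← mul_div_assoc, show t * (n ^ 2 * t) = n ^ 2 * t ^ 2 by ring]
  positivity

/-- The compression of a functional on the unitization by an element of the unitization, as a
functional on the algebra. -/
def compress (f : StrongDual ℂ (Unitization ℂ A)) (d : Unitization ℂ A) : StrongDual ℂ A :=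
  f ∘L ContinuousLinearMap.mulLeftRight ℂ (Unitization ℂ A) (star d) d ∘L
    ({ toLinearMap := Unitization.inrHom ℂ ℂ A, cont := Unitization.continuous_inr } :
        A →L[ℂ] Unitization ℂ A)

omit [PartialOrder A] [StarOrderedRing A] in
theorem compress_apply (f : StrongDual ℂ (Unitization ℂ A)) (d : Unitization ℂ A) (a : A) :
    compress f d a = f (star d * a * d) := rfl

namespace IsStrictlyPositiveElement

variable {h : A} (hh : IsStrictlyPositiveElement h)
include hh

/-- Put dₙ = 1 − uₙ, where uₙ is `approxUnit h n`. If ‖a dₙ‖ ≥ δ along an ultrafilter, take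
functionals fₙ norming dₙ a*a dₙ. By Banach–Alaoglu the compressions fₙ(dₙ · dₙ) have a weak* limit
ψ ≥ 0. Then ψ(h) = 0 because ‖h dₙ‖ ≤ 1/n, yet |ψ(a*a)| ≥ δ², so normalizing ψ yields a state that
contradicts strict positivity of h. -/
theorem tendsto_mul_approxUnit (a : A) : Tendsto (fun n => a * approxUnit h n) atTop (𝓝 a) := by
  rw [tendsto_iff_norm_sub_tendsto_zero]
  by_contra hcon
  obtain ⟨δ, hδ, hfr⟩ : ∃ δ > 0, ∃ᶠ n in atTop, δ ≤ ‖a * approxUnit h n - a‖ := by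
    rw [Metric.tendsto_nhds] at hcon
    push Not at hcon
    obtain ⟨δ, hδ, hfr⟩ := hcon
    exact ⟨δ, hδ, hfr.mono fun n hn => by simpa using hn⟩
  have : (atTop ⊓ 𝓟 {n | δ ≤ ‖a * approxUnit h n - a‖} : Filter ℕ).NeBot :=
    frequently_mem_iff_neBot.1 hfr
  let U : Ultrafilter ℕ := Ultrafilter.of (atTop ⊓ 𝓟 {n | δ ≤ ‖a * approxUnit h n - a‖})
  have hU : (U : Filter ℕ) ≤ atTop ⊓ 𝓟 {n | δ ≤ ‖a * approxUnit h n - a‖} := Ultrafilter.of_le _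
  have hU1 : (U : Filter ℕ) ≤ atTop := hU.trans inf_le_left
  have hU2 : ∀ᶠ n in (U : Filter ℕ), δ ≤ ‖a * approxUnit h n - a‖ :=
    (hU.trans inf_le_right) (mem_principal_self _)
  let d : ℕ → Unitization ℂ A := fun n => 1 - approxUnit h n
  have hd0 : ∀ n, 0 ≤ d n := fun n => sub_nonneg.2 ((CStarAlgebra.norm_le_one_iff_of_nonneg _
    (Unitization.inr_nonneg_iff.2 (approxUnit_nonneg h n))).1
      (by rw [Unitization.norm_inr]; exact norm_approxUnit_le h n))
  have hd1 : ∀ n, ‖d n‖ ≤ 1 := fun n => (CStarAlgebra.norm_le_one_iff_of_nonneg _ (hd0 n)).2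
    (sub_le_self _ (Unitization.inr_nonneg_iff.2 (approxUnit_nonneg h n)))
  have hex : ∀ n, ∃ f : StrongDual ℂ (Unitization ℂ A), f 1 = 1 ∧ (∀ x, ‖f x‖ ≤ ‖x‖) ∧
      ‖f (star (d n) * (star a * a : A) * d n)‖ = ‖star (d n) * (star a * a : A) * d n‖ :=
    fun n => exists_functional_norm_eq <| by
      rw [mul_assoc]
      exact IsSelfAdjoint.conjugate' ((IsSelfAdjoint.star_mul_self a).inr ℂ) (d n) |> fun h => by
        rwa [mul_assoc] at h
  choose f hf1 hf hfn using hex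
  have hψ : ∀ n x, ‖compress (f n) (d n) x‖ ≤ ‖x‖ := fun n x => by
    rw [compress_apply]
    refine (hf n _).trans ((norm_mul_le _ _).trans ?_)
    refine (mul_le_of_le_one_right (norm_nonneg _) (hd1 n)).trans ((norm_mul_le _ _).trans ?_)
    rw [norm_star, Unitization.norm_inr]
    exact mul_le_of_le_one_left (norm_nonneg _) (hd1 n)
  obtain ⟨ψ, hψB, hlim⟩ := isCompact_iff_ultrafilter_le_nhds.1
    (WeakDual.isCompact_closedBall (0 : StrongDual ℂ A) 1)
    (U.map fun n => StrongDual.toWeakDual (compress (f n) (d n))) (by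
      rw [le_principal_iff]
      refine Filter.mem_map.2 (Filter.univ_mem' fun n => ?_)
      simpa using (compress (f n) (d n)).opNorm_le_bound zero_le_one
        fun x => by simpa using hψ n x)
  have hev : ∀ x : A, Tendsto (fun n => compress (f n) (d n) x) U (𝓝 (ψ x)) := fun x =>
    ((WeakDual.eval_continuous x).tendsto ψ).comp (show Tendsto
      (fun n => StrongDual.toWeakDual (compress (f n) (d n))) U (𝓝 ψ) from hlim)
  have hpos : ∀ x : A, 0 ≤ x → 0 ≤ ψ x := fun x hx =>
    ge_of_tendsto (hev x) (Eventually.of_forall fun n =>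
      apply_nonneg_of_norm_le (hf1 n) (hf n)
        (star_left_conjugate_nonneg (Unitization.inr_nonneg_iff.2 hx) _))
  have hle : ∀ x : A, ‖ψ x‖ ≤ ‖x‖ := fun x =>
    le_of_tendsto (hev x).norm (Eventually.of_forall fun n => hψ n x)
  have hh0 : ψ h = 0 := by
    refine tendsto_nhds_unique (hev h) (squeeze_zero_norm' ?_
      ((tendsto_one_div_atTop_nhds_zero_nat).mono_left hU1))
    filter_upwards [hU1 (eventually_gt_atTop 0)] with n hn
    rw [compress_apply]
    refine (hf n _).trans ?_
    rw [mul_assoc]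
    refine (norm_mul_le _ _).trans ?_
    rw [norm_star]
    refine (mul_le_of_le_one_left (norm_nonneg _) (hd1 n)).trans ?_
    have : (h : Unitization ℂ A) * d n = (h - h * approxUnit h n : A) := by
      simp [d, mul_sub]
    rw [this, Unitization.norm_inr]
    exact norm_sub_mul_approxUnit_le hh.1.isSelfAdjoint hn
  have hge : δ ^ 2 ≤ ‖ψ (star a * a)‖ := by
    refine ge_of_tendsto (hev (star a * a)).norm ?_
    filter_upwards [hU2] with n hn
    rw [compress_apply, hfn]
    have e : star (d n) * ((star a * a : A) : Unitization ℂ A) * d n =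
        star ((a - a * approxUnit h n : A) : Unitization ℂ A) * (a - a * approxUnit h n : A) := by
      have : ((a - a * approxUnit h n : A) : Unitization ℂ A) = a * d n := by simp [d, mul_sub]
      rw [this, star_mul, Unitization.inr_mul, Unitization.inr_star]
      noncomm_ring
    rw [e, CStarRing.norm_star_mul_self, Unitization.norm_inr, norm_sub_rev, ← sq]
    gcongr
  have hne : WeakDual.toStrongDual ψ ≠ 0 := fun h0 => by
    have : ψ (star a * a) = 0 := congrArg (fun F : StrongDual ℂ A => F (star a * a)) h0
    rw [this, norm_zero] at hge
    nlinarith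
  have hn0 : ‖WeakDual.toStrongDual ψ‖ ≠ 0 := norm_ne_zero_iff.2 hne
  let r : ℂ := (‖WeakDual.toStrongDual ψ‖⁻¹ : ℝ)
  let φ : StateSpace A := ⟨StrongDual.toWeakDual (r • WeakDual.toStrongDual ψ),
    fun x hx => by
      show 0 ≤ r * ψ x
      exact mul_nonneg (Complex.zero_le_real.2 (by positivity)) (hpos x hx), by
    show ‖r • WeakDual.toStrongDual ψ‖ = 1
    rw [norm_smul, Complex.norm_real, norm_inv, norm_norm, inv_mul_cancel₀ hn0]⟩
  have h1 := hh.2 φ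
  have h2 : φ.eval h = r * ψ h := rfl
  rw [h2, hh0, mul_zero] at h1
  exact lt_irrefl _ h1

theorem tendsto_approxUnit_mul (a : A) : Tendsto (fun n => approxUnit h n * a) atTop (𝓝 a) := by
  have h1 := (continuous_star.tendsto _).comp (hh.tendsto_mul_approxUnit (star a))
  rw [star_star] at h1
  refine h1.congr fun n => ?_
  rw [Function.comp_apply, star_mul, star_star, (approxUnit_nonneg h n).star_eq]

theorem isTopography : IsTopography (NonUnitalStarAlgebra.elemental ℂ h) where
  isClosed := NonUnitalStarAlgebra.elemental.isClosed ℂ h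
  comm a ha b hb := by
    have : IsStarNormal h := hh.1.isSelfAdjoint.isStarNormal
    exact congrArg Subtype.val (mul_comm (⟨a, ha⟩ : NonUnitalStarAlgebra.elemental ℂ h) ⟨b, hb⟩)
  approx := by
    refine ⟨map (approxUnit h) atTop,
      { tendsto_mul_left := fun m => tendsto_map'_iff.2 (hh.tendsto_mul_approxUnit m)
        tendsto_mul_right := fun m => tendsto_map'_iff.2 (hh.tendsto_approxUnit_mul m)
        neBot := inferInstance
        eventually_nonneg := eventually_map.2 (Eventually.of_forall (approxUnit_nonneg h))
        eventually_norm := eventually_map.2 (Eventually.of_forall (norm_approxUnit_le h)) }, ?_⟩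
    exact eventually_map.2
      (Eventually.of_forall (approxUnit_mem_elemental hh.1.isSelfAdjoint))

theorem exists_norm_sub_mul_lt (a : A) {ε : ℝ} (hε : 0 < ε) : ∃ b : A, ‖a - h * b‖ < ε := by
  obtain ⟨n, hn⟩ := ((Metric.tendsto_nhds.1 (hh.tendsto_approxUnit_mul a)) ε hε).exists
  refine ⟨approxInv h n * a, ?_⟩
  rwa [dist_comm, dist_eq_norm, approxUnit_eq_mul hh.1.isSelfAdjoint, mul_assoc] at hn

/-- Write a ≈ hb and take a bump c = g(h) concentrated near a small point s of the quasispectrum. A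
state with φ(c) = 1 satisfies φ(a) = φ(ca), and ca ≈ chb is small. -/
theorem exists_norm_eval_lt (hA : ¬ IsUnitalAlgebra A) (a : A) {ε : ℝ} (hε : 0 < ε) :
    ∃ φ : StateSpace A, ‖φ.eval a‖ < ε := by
  have hsa := hh.1.isSelfAdjoint
  -- If the quasispectrum of h missed (0, η), then min(t/η, 1) would equal 1 on its nonzero points,
  -- and the corresponding function of h would be a unit of A.
  have hspec : ∀ η > 0, ∃ s ∈ quasispectrum ℝ h, 0 < s ∧ s < η := by
    by_contra! hcon
    obtain ⟨η, hη, hcon⟩ := hcon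
    apply hA
    have hc : Continuous fun t : ℝ => min (t / η) 1 := by fun_prop
    have hz : min ((0 : ℝ) / η) 1 = 0 := by simp
    have hph : cfcₙ (fun t : ℝ => min (t / η) 1) h * h = h := by
      conv_lhs => rw [← cfcₙ_id' ℝ h, cfcₙ_id' ℝ h]
      nth_rewrite 2 [← cfcₙ_id' ℝ h]
      rw [← cfcₙ_mul _ _ h hc.continuousOn hz (by fun_prop) rfl]
      conv_rhs => rw [← cfcₙ_id' ℝ h]
      refine cfcₙ_congr fun t ht => ?_
      have h0 : 0 ≤ t := quasispectrum_nonneg_of_nonneg h hh.1 t ht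
      rcases h0.eq_or_lt with rfl | h0
      · simp
      · have := hcon t ht h0
        have h1 : 1 ≤ t / η := (one_le_div hη).2 this
        simp [min_eq_right h1]
    set p := cfcₙ (fun t : ℝ => min (t / η) 1) h with hp
    have hpsa : IsSelfAdjoint p := cfcₙ_predicate _ _
    have hleft : ∀ b : A, p * b = b := fun b => by
      have h1 : Tendsto (fun n => p * (approxUnit h n * b)) atTop (𝓝 (p * b)) :=
        (continuous_const_mul p).tendsto b |>.comp (hh.tendsto_approxUnit_mul b)
      refine tendsto_nhds_unique h1 ((hh.tendsto_approxUnit_mul b).congr fun n => ?_)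
      rw [approxUnit_eq_mul hsa, ← mul_assoc, ← mul_assoc, hph]
    refine ⟨p, fun b => ⟨hleft b, ?_⟩⟩
    have := congrArg star (hleft (star b))
    rwa [star_mul, star_star, hpsa.star_eq] at this
  obtain ⟨b, hb⟩ := hh.exists_norm_sub_mul_lt a (half_pos hε)
  -- The bump below is 1 at s and 0 beyond 2s, so ‖ch‖ ≤ 2s. This choice of η makes ‖chb‖ ≤ ε/2.
  obtain ⟨s, hs, hs0, hsη⟩ := hspec (ε / 4 / (‖b‖ + 1)) (by positivity)
  have hc : Continuous fun t : ℝ => max 0 (1 - |t / s - 1|) := by fun_prop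
  have hz : max 0 (1 - |(0 : ℝ) / s - 1|) = 0 := by simp
  set c := cfcₙ (fun t : ℝ => max 0 (1 - |t / s - 1|)) h with hcdef
  have hc0 : 0 ≤ c := cfcₙ_nonneg fun t _ => le_max_left _ _
  have hc1 : ‖c‖ = 1 := by
    refine le_antisymm (norm_cfcₙ_le fun t _ => ?_) ?_
    · rw [Real.norm_of_nonneg (le_max_left _ _)]
      exact max_le zero_le_one (sub_le_self _ (abs_nonneg _))
    · have := norm_apply_le_norm_cfcₙ _ h hs hc.continuousOn hz
      simpa [div_self hs0.ne'] using this
  have hch : ‖c * h‖ ≤ 2 * s := by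
    conv_lhs => rw [← cfcₙ_id' ℝ h]
    rw [hcdef, cfcₙ_id' ℝ h]
    nth_rewrite 2 [← cfcₙ_id' ℝ h]
    rw [← cfcₙ_mul _ _ h hc.continuousOn hz (by fun_prop) rfl]
    refine norm_cfcₙ_le fun t ht => ?_
    have h0 : 0 ≤ t := quasispectrum_nonneg_of_nonneg h hh.1 t ht
    rw [norm_mul, Real.norm_of_nonneg (le_max_left _ _), Real.norm_of_nonneg h0]
    rcases le_total t (2 * s) with h1 | h1
    · refine (mul_le_of_le_one_left h0 ?_).trans h1
      exact max_le zero_le_one (sub_le_self _ (abs_nonneg _))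
    · have : 1 - |t / s - 1| ≤ 0 := by
        have : 2 ≤ t / s := (le_div_iff₀ hs0).2 h1
        have := le_abs_self (t / s - 1)
        linarith
      rw [max_eq_left this, zero_mul]
      positivity
  have hcne : c ≠ 0 := fun h0 => by simp [h0] at hc1
  obtain ⟨φ, hφ⟩ := StateSpace.exists_norm_eval_eq hc0.isSelfAdjoint hcne
  have hφc : φ.eval c = 1 := by
    have h1 := φ.eval_nonneg hc0
    rw [Complex.eq_coe_norm_of_nonneg h1, hφ, hc1, Complex.ofReal_one]
  refine ⟨φ, ?_⟩
  have h1 := φ.extend_mul_eq' hc0 hc1.le hφc a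
  rw [← Unitization.inr_mul, φ.extend_inr, φ.extend_inr] at h1
  rw [← h1]
  refine (φ.norm_eval_le _).trans_lt ?_
  have e : c * a = c * (a - h * b) + c * h * b := by noncomm_ring
  rw [e]
  have h2 : ‖c * (a - h * b)‖ < ε / 2 :=
    (norm_mul_le _ _).trans_lt (by rwa [hc1, one_mul])
  have h3 : ‖c * h * b‖ ≤ ε / 2 := by
    refine (norm_mul_le _ _).trans ?_
    rw [lt_div_iff₀ (by positivity)] at hsη
    nlinarith [norm_nonneg b, norm_nonneg (c * h)]
  exact (norm_add_le _ _).trans_lt (by linarith)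

end IsStrictlyPositiveElement

end StrictlyPositive

/-! ### Total boundedness of images -/

section TotallyBounded

variable {ι E : Type*} [SeminormedAddCommGroup E]

theorem totallyBounded_image_iff {S : Set ι} {F : ι → E} :
    TotallyBounded (F '' S) ↔
      ∀ ε > 0, ∃ u ⊆ S, u.Finite ∧ ∀ a ∈ S, ∃ b ∈ u, ‖F a - F b‖ < ε := by
  constructor
  · intro h ε hε
    obtain ⟨u, huS, huf, ht⟩ := Set.exists_subset_image_finite_and.1
      (Metric.finite_approx_of_totallyBounded h ε hε)
    refine ⟨u, huS, huf, fun a ha => ?_⟩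
    have := ht (Set.mem_image_of_mem F ha)
    simp only [Set.mem_iUnion, Metric.mem_ball, dist_eq_norm] at this
    obtain ⟨_, ⟨b, hb, rfl⟩, hab⟩ := this
    exact ⟨b, hb, hab⟩
  · intro h
    refine Metric.totallyBounded_iff.2 fun ε hε => ?_
    obtain ⟨u, -, huf, hu⟩ := h ε hε
    refine ⟨F '' u, huf.image F, ?_⟩
    rintro _ ⟨a, ha, rfl⟩
    obtain ⟨b, hb, hab⟩ := hu a ha
    simp only [Set.mem_iUnion, Metric.mem_ball, dist_eq_norm]
    exact ⟨F b, ⟨b, hb, rfl⟩, hab⟩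

theorem totallyBounded_image_of_approx {S : Set ι} {G : ι → E}
    (h : ∀ δ > 0, ∃ F : ι → E, TotallyBounded (F '' S) ∧ ∀ a ∈ S, ‖F a - G a‖ ≤ δ) :
    TotallyBounded (G '' S) := by
  refine totallyBounded_image_iff.2 fun ε hε => ?_
  obtain ⟨F, hF, hFG⟩ := h (ε / 3) (by positivity)
  obtain ⟨u, huS, huf, hu⟩ := totallyBounded_image_iff.1 hF (ε / 3) (by positivity)
  refine ⟨u, huS, huf, fun a ha => ?_⟩
  obtain ⟨b, hb, hab⟩ := hu a ha
  refine ⟨b, hb, ?_⟩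
  have e : G a - G b = -(F a - G a) + (F a - F b) + (F b - G b) := by abel
  rw [e]
  have h1 := norm_add₃_le (a := -(F a - G a)) (b := F a - F b) (c := F b - G b)
  rw [norm_neg] at h1
  linarith [hFG a ha, hFG b (huS hb)]

end TotallyBounded

/-! ### Comparing a topology with that of an extended pseudometric -/

section PseudoEMetric

variable {X : Type*}

/-- The pseudometric is an explicit argument because state spaces already carry the weak* topology
as an instance. -/
theorem eventually_edist_lt (m : PseudoEMetricSpace X) (x : X) {ε : ℝ≥0∞} (hε : 0 < ε) :
    ∀ᶠ y in @nhds X m.toUniformSpace.toTopologicalSpace x, m.edist y x < ε :=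
  Metric.eball_mem_nhds x hε

theorem le_toTopologicalSpace (m : PseudoEMetricSpace X) (t : TopologicalSpace X)
    (H : ∀ x, ∀ ε > 0, ∀ᶠ y in @nhds X t x, m.edist y x < ε) :
    t ≤ m.toUniformSpace.toTopologicalSpace := by
  refine le_of_nhds_le_nhds fun x => ?_
  exact (Metric.nhds_basis_eball (x := x)).ge_iff.2 fun ε hε => H x ε hε

end PseudoEMetric

/-! ### The Lipschitz ball and the comparison of `mk_L` with the weak* topology -/

namespace LipschitzPair

variable {A : Type*} [NonUnitalCStarAlgebra A] (P : LipschitzPair A)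

theorem isSelfAdjoint_of_mem_lipBall {a : A} (ha : a ∈ P.lipBall) : IsSelfAdjoint a := by
  obtain ⟨x, hx, -⟩ := ha
  have h : IsSelfAdjoint (a : Unitization ℂ A) := hx ▸ x.1.2
  have h2 := h.star_eq
  rw [← Unitization.inr_star] at h2
  exact Unitization.inr_injective h2

/-- The unit belongs to the domain of `L`, so the scalar part of x can be subtracted there; what
remains is in A and can be rescaled into the ball. -/
theorem snd_mem_span_lipBall (x : P.dom) :
    ((x : selfAdjoint (Unitization ℂ A)) : Unitization ℂ A).snd ∈ Submodule.span ℂ P.lipBall := by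
  obtain ⟨h1, -⟩ := (P.L_eq_zero_iff 1).2 ⟨1, Subtype.ext (one_smul ℝ (1 : Unitization ℂ A)).symm⟩
  set d := ((x : selfAdjoint (Unitization ℂ A)) : Unitization ℂ A) with hd
  have hsa : star d = d := x.1.2
  have hfst : ((d.fst.re : ℝ) : ℂ) = d.fst := by
    have := congrArg (fun z : Unitization ℂ A => z.fst) hsa
    rw [Unitization.fst_star] at this
    exact Complex.conj_eq_iff_re.1 this
  let y : P.dom := x - d.fst.re • ⟨1, h1⟩
  have hy : ((y : selfAdjoint (Unitization ℂ A)) : Unitization ℂ A) = (d.snd : Unitization ℂ A) := by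
    have e : ((y : selfAdjoint (Unitization ℂ A)) : Unitization ℂ A) =
        d - d.fst.re • (1 : Unitization ℂ A) := rfl
    rw [e]
    apply Unitization.ext
    · rw [sub_eq_add_neg, Unitization.fst_add, Unitization.fst_neg, Unitization.fst_smul, Unitization.fst_one, Unitization.fst_inr,
        Complex.real_smul, mul_one, hfst, add_neg_cancel]
    · rw [sub_eq_add_neg, Unitization.snd_add, Unitization.snd_neg, Unitization.snd_smul, Unitization.snd_one, Unitization.snd_inr,
        smul_zero, neg_zero, add_zero]
  -- The added 1 keeps the scaling factor nonzero even when `L` vanishes at y.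
  set c : ℝ := P.L y + 1
  have hc : 0 < c := by have := apply_nonneg P.L y; positivity
  have hmem : c⁻¹ • d.snd ∈ P.lipBall := by
    refine ⟨c⁻¹ • y, ?_, ?_⟩
    · rw [Unitization.inr_smul, ← hy]; rfl
    · rw [map_smul_eq_mul, Real.norm_of_nonneg (by positivity), inv_mul_le_iff₀ hc]
      linarith
  have := (Submodule.span ℂ P.lipBall).smul_mem (c : ℂ) (Submodule.subset_span hmem)
  rwa [Complex.coe_smul, smul_inv_smul₀ hc.ne'] at this

theorem dense_span_lipBall : Dense (Submodule.span ℂ P.lipBall : Set A) := by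
  have hsa : ∀ a : A, IsSelfAdjoint a → a ∈ (Submodule.span ℂ P.lipBall).topologicalClosure := by
    intro a ha
    have hcont : Continuous fun x : selfAdjoint (Unitization ℂ A) => (x : Unitization ℂ A).snd :=
      Unitization.continuous_snd.comp continuous_subtype_val
    have h1 := mem_closure_image (hcont.continuousAt (x := ⟨(a : Unitization ℂ A), ha.inr ℂ⟩))
      (P.dense_dom _)
    refine closure_mono ?_ h1
    rintro _ ⟨x, hx, rfl⟩
    exact P.snd_mem_span_lipBall ⟨x, hx⟩
  rw [Submodule.dense_iff_topologicalClosure_eq_top, eq_top_iff]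
  intro a _
  rw [← realPart_add_I_smul_imaginaryPart a]
  exact add_mem (hsa _ (realPart a).2) (Submodule.smul_mem _ _ (hsa _ (imaginaryPart a).2))

variable [PartialOrder A]

variable {P}

theorem norm_eval_sub_le_of_mkDist_le {φ ψ : StateSpace A} {r : ℝ} (hr : 0 ≤ r)
    (h : P.mkDist φ ψ ≤ ENNReal.ofReal r) {a : A} (ha : a ∈ P.lipBall) :
    ‖φ.eval a - ψ.eval a‖ ≤ r := by
  have h1 := (le_iSup₂ (f := fun a (_ : a ∈ P.lipBall) => ‖φ.eval a - ψ.eval a‖ₑ) a ha).trans h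
  rw [← ofReal_norm] at h1
  exact (ENNReal.ofReal_le_ofReal_iff hr).1 h1

theorem mkDist_le {φ ψ : StateSpace A} {r : ℝ}
    (h : ∀ a ∈ P.lipBall, ‖φ.eval a - ψ.eval a‖ ≤ r) : P.mkDist φ ψ ≤ ENNReal.ofReal r :=
  iSup₂_le fun a ha => by
    rw [← ofReal_norm]
    exact ENNReal.ofReal_le_ofReal (h a ha)

theorem mkDiam_lt_top {B : ℝ} (hB : ∀ a ∈ P.lipBall, ‖a‖ ≤ B) (S : Set (StateSpace A)) :
    P.mkDiam S < ⊤ := by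
  refine lt_of_le_of_lt ?_ (ENNReal.ofReal_lt_top (r := 2 * B))
  refine iSup₂_le fun φ _ => iSup₂_le fun ψ _ => mkDist_le fun a ha => ?_
  refine (norm_sub_le _ _).trans ?_
  linarith [φ.norm_eval_le a, ψ.norm_eval_le a, hB a ha]

/-- The elements of A at which evaluation is continuous at φ₀ for `mk_L` form a subspace, closed
because states are contractive. It contains the Lipschitz ball, whose span is dense. -/
theorem mkTopology_le : P.mkTopology ≤ StateSpace.instTopologicalSpace A := by
  refine le_of_nhds_le_nhds fun φ₀ => ?_
  have hnear := fun ε hε => eventually_edist_lt P.mkPseudoEMetricSpace φ₀ (ε := ε) hε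
  set N := @nhds _ P.mkTopology φ₀
  suffices h : ∀ a : A, Tendsto (fun φ : StateSpace A => φ.eval a) N (𝓝 (φ₀.eval a)) by
    have h' : Tendsto (fun φ : StateSpace A => φ.1) N (𝓝 φ₀.1) :=
      tendsto_iff_forall_eval_tendsto_topDualPairing.2 h
    exact (tendsto_iff_comap.1 h').trans (nhds_induced _ _).ge
  let V : Submodule ℂ A :=
    { carrier := {a | Tendsto (fun φ : StateSpace A => φ.eval a) N (𝓝 (φ₀.eval a))}
      add_mem' := fun {a b} ha hb => by
        simp only [Set.mem_ofPred_eq, StateSpace.eval_add] at *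
        exact ha.add hb
      zero_mem' := by
        have : (fun φ : StateSpace A => φ.eval 0) = fun _ => 0 := funext fun φ => map_zero φ.1
        simp only [Set.mem_ofPred_eq, this, show φ₀.eval 0 = 0 from map_zero φ₀.1]
        exact tendsto_const_nhds
      smul_mem' := fun c a ha => by
        simp only [Set.mem_ofPred_eq, StateSpace.eval_smul] at *
        exact tendsto_const_nhds.mul ha }
  have hV : IsClosed (V : Set A) := by
    refine isClosed_of_closure_subset fun a ha => ?_
    show Tendsto (fun φ : StateSpace A => φ.eval a) N (𝓝 (φ₀.eval a))
    refine Metric.tendsto_nhds.2 fun ε hε => ?_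
    obtain ⟨b, hb, hab⟩ := Metric.mem_closure_iff.1 ha (ε / 3) (by positivity)
    rw [dist_eq_norm] at hab
    filter_upwards [Metric.tendsto_nhds.1 hb (ε / 3) (by positivity)] with φ hφ
    rw [dist_eq_norm] at hφ ⊢
    have e : φ.eval a - φ₀.eval a =
        φ.eval (a - b) + (φ.eval b - φ₀.eval b) - φ₀.eval (a - b) := by
      rw [StateSpace.eval_sub, StateSpace.eval_sub]; ring
    rw [e]
    have h1 := norm_sub_le (φ.eval (a - b) + (φ.eval b - φ₀.eval b)) (φ₀.eval (a - b))
    have h2 := norm_add_le (φ.eval (a - b)) (φ.eval b - φ₀.eval b)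
    linarith [φ.norm_eval_le (a - b), φ₀.norm_eval_le (a - b)]
  have hsub : P.lipBall ⊆ V := fun a ha => by
    show Tendsto (fun φ : StateSpace A => φ.eval a) N (𝓝 (φ₀.eval a))
    refine Metric.tendsto_nhds.2 fun ε hε => ?_
    filter_upwards [hnear (ENNReal.ofReal (ε / 2)) (by simpa using hε)] with φ hφ
    rw [dist_eq_norm]
    exact (norm_eval_sub_le_of_mkDist_le (half_pos hε).le hφ.le ha).trans_lt (half_lt_self hε)
  intro a
  have h1 : (Submodule.span ℂ P.lipBall).topologicalClosure ≤ V :=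
    Submodule.topologicalClosure_minimal _ (Submodule.span_le.2 hsub) hV
  exact h1 (P.dense_span_lipBall a)

variable [StarOrderedRing A] {h : A} (hh : IsStrictlyPositiveElement h)
  {B : ℝ} (hB : ∀ a ∈ P.lipBall, ‖a‖ ≤ B)
  (htb : TotallyBounded ((fun a : A => h * a * h) '' P.lipBall))
include hh htb

/-- hAh is dense, since hA is and h is self-adjoint. Hence the span of the totally bounded, thus
separable, set h𝔏h is dense too. -/
theorem separableSpace : SeparableSpace A := by
  have hsa : star h = h := hh.1.star_eq
  let T : A →L[ℂ] A := ContinuousLinearMap.mulLeftRight ℂ A h h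
  have hT : ∀ a, T a = h * a * h := fun a => rfl
  have hdense : DenseRange T := by
    intro a
    rw [Metric.mem_closure_iff]
    intro ε hε
    obtain ⟨b, hb⟩ := hh.exists_norm_sub_mul_lt a (half_pos hε)
    obtain ⟨c, hc⟩ := hh.exists_norm_sub_mul_lt (star b)
      (show 0 < ε / 2 / (‖h‖ + 1) by positivity)
    refine ⟨_, ⟨star c, rfl⟩, ?_⟩
    have e : a - T (star c) = (a - h * b) + h * star (star b - h * c) := by
      rw [hT, star_sub, star_star, star_mul, hsa]; noncomm_ring
    rw [dist_eq_norm, e]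
    refine (norm_add_le _ _).trans_lt ?_
    have h2 : ‖h * star (star b - h * c)‖ ≤ ε / 2 := by
      refine (norm_mul_le _ _).trans ?_
      rw [norm_star]
      rw [lt_div_iff₀ (by positivity)] at hc
      nlinarith [norm_nonneg h, norm_nonneg (star b - h * c)]
    linarith
  have hd2 := hdense.dense_image T.continuous P.dense_span_lipBall
  have himage : T '' (Submodule.span ℂ P.lipBall : Set A) =
      (Submodule.span ℂ ((fun a : A => h * a * h) '' P.lipBall) : Set A) := by
    have := Submodule.map_span T.toLinearMap P.lipBall
    exact congrArg (SetLike.coe) this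
  rw [himage] at hd2
  have hsep := (htb.isSeparable.span (R := ℂ)).closure
  rw [hd2.closure_eq] at hsep
  exact isSeparable_univ_iff.1 hsep

include hB

theorem totallyBounded_conj (e : A) :
    TotallyBounded ((fun a : A => star e * a * e) '' P.lipBall) := by
  have hsa : star h = h := hh.1.star_eq
  rcases P.lipBall.eq_empty_or_nonempty with h0 | ⟨a₀, ha₀⟩
  · rw [h0, Set.image_empty]; exact totallyBounded_empty
  have hB0 : 0 ≤ B := (norm_nonneg _).trans (hB a₀ ha₀)
  refine totallyBounded_image_of_approx fun δ hδ => ?_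
  -- With k = hb, the 1 in the minimum gives ‖k‖ ≤ ‖e‖ + 1, and the error is then at most ‖e − k‖ B
  -- (2‖e‖ + 1).
  obtain ⟨b, hb⟩ := hh.exists_norm_sub_mul_lt e
    (show 0 < min 1 (δ / ((B + 1) * (2 * ‖e‖ + 1))) by positivity)
  refine ⟨fun a => star b * (h * a * h) * b, ?_, fun a ha => ?_⟩
  · have := htb.image (ContinuousLinearMap.mulLeftRight ℂ A (star b) b).uniformContinuous
    rw [Set.image_image] at this
    exact this
  · have h1 := hb.trans_le (min_le_left _ _)
    have h2 := hb.trans_le (min_le_right _ _)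
    rw [lt_div_iff₀ (by positivity)] at h2
    set k := h * b with hk
    have e1 : star b * (h * a * h) * b = star k * a * k := by
      rw [hk, star_mul, hsa]; noncomm_ring
    have e2 : star k * a * k - star e * a * e =
        -(star (e - k) * a * k + star e * a * (e - k)) := by rw [star_sub]; noncomm_ring
    have h3 : ‖k‖ ≤ ‖e‖ + 1 := by
      have : k = e - (e - k) := by abel
      rw [this]; exact (norm_sub_le _ _).trans (by linarith)
    show ‖star b * (h * a * h) * b - star e * a * e‖ ≤ δ
    rw [e1, e2, norm_neg]
    have h4 : ‖star (e - k) * a * k‖ ≤ ‖e - k‖ * B * (‖e‖ + 1) := by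
      refine (norm_mul_le _ _).trans ?_
      refine mul_le_mul ((norm_mul_le _ _).trans ?_) h3 (norm_nonneg _) (by positivity)
      rw [norm_star]
      exact mul_le_mul_of_nonneg_left (hB a ha) (norm_nonneg _)
    have h5 : ‖star e * a * (e - k)‖ ≤ ‖e‖ * B * ‖e - k‖ := by
      refine (norm_mul_le _ _).trans ?_
      refine mul_le_mul_of_nonneg_right ((norm_mul_le _ _).trans ?_) (norm_nonneg _)
      rw [norm_star]
      exact mul_le_mul_of_nonneg_left (hB a ha) (norm_nonneg _)
    refine (norm_add_le _ _).trans ?_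
    nlinarith [norm_nonneg (e - k), norm_nonneg e,
      mul_nonneg (norm_nonneg (e - k)) (norm_nonneg e)]

theorem mkTopology_eq : P.mkTopology = StateSpace.instTopologicalSpace A := by
  refine le_antisymm mkTopology_le ?_
  refine le_toTopologicalSpace _ _ fun φ₀ ε hε => ?_
  obtain ⟨r, -, hrε⟩ := ENNReal.lt_iff_exists_real_btwn.1 hε
  obtain ⟨hr, hrε⟩ : 0 < r ∧ ENNReal.ofReal r < ε := ⟨ENNReal.ofReal_pos.1 hrε.1, hrε.2⟩
  -- Each of the two compression errors 2‖a‖δ becomes at most r/4; three further terms of size r/8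
  -- leave the total below r.
  set δ : ℝ := min 1 (r / (8 * (|B| + 1))) with hδ
  have hδ0 : 0 < δ := by positivity
  have hδr : δ * (8 * (|B| + 1)) ≤ r := (le_div_iff₀ (by positivity)).1 (min_le_right _ _)
  obtain ⟨e, he0, he1, he⟩ : ∃ e : A, 0 ≤ e ∧ ‖e‖ ≤ 1 ∧ 1 - δ ^ 2 < (φ₀.eval e).re := by
    -- Since ‖φ₀‖ = 1, some a in the unit ball has |φ₀(a)| > 1 − δ²/2, so φ₀(a*a) ≥ |φ₀(a)|² > 1 −
    -- δ².
    obtain ⟨a, ha1, ha⟩ := (WeakDual.toStrongDual φ₀.1).exists_lt_apply_of_lt_opNorm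
      (r := 1 - δ ^ 2 / 2) (by rw [φ₀.2.2]; have := pow_pos hδ0 2; linarith)
    refine ⟨star a * a, star_mul_self_nonneg a, ?_, lt_of_lt_of_le ?_ (φ₀.norm_eval_sq_le a)⟩
    · rw [CStarRing.norm_star_mul_self]
      exact mul_le_one₀ ha1.le (norm_nonneg _) ha1.le
    · have h1 : δ ^ 2 ≤ 1 := pow_le_one₀ hδ0.le (min_le_left _ _)
      have h2 : 1 - δ ^ 2 / 2 < ‖φ₀.eval a‖ := ha
      nlinarith [sq_nonneg (δ ^ 2)]
  obtain ⟨u, huS, huf, hu⟩ := totallyBounded_image_iff.1 (totallyBounded_conj hh hB htb e)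
    (r / 8) (by positivity)
  have hnear : ∀ᶠ φ in 𝓝 φ₀, 1 - δ ^ 2 < (φ.eval e).re :=
    (Complex.continuous_re.comp (StateSpace.continuous_eval e)).continuousAt.eventually
      (lt_mem_nhds he)
  have hnear2 : ∀ᶠ φ in 𝓝 φ₀, ∀ b ∈ u, ‖φ.eval (e * b * e) - φ₀.eval (e * b * e)‖ < r / 8 := by
    refine (eventually_all_finite huf).2 fun b _ => ?_
    have := (StateSpace.continuous_eval (e * b * e)).continuousAt (x := φ₀)
    simpa [dist_eq_norm] using Metric.tendsto_nhds.1 this (r / 8) (by positivity)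
  filter_upwards [hnear, hnear2] with φ hφ hφ2
  refine lt_of_le_of_lt (mkDist_le fun a ha => ?_) hrε
  obtain ⟨b, hb, hab⟩ := hu a ha
  rw [he0.star_eq] at hab
  have h1 := φ.norm_eval_sub_eval_mul_mul_le a he0 he1 hδ0.le hφ.le
  have h2 := φ₀.norm_eval_sub_eval_mul_mul_le a he0 he1 hδ0.le he.le
  have h3 := φ.norm_eval_le (e * a * e - e * b * e)
  have h4 := φ₀.norm_eval_le (e * a * e - e * b * e)
  rw [StateSpace.eval_sub] at h3 h4
  have h5 := hφ2 b hb
  have e1 : φ.eval a - φ₀.eval a = (φ.eval a - φ.eval (e * a * e)) +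
      (φ.eval (e * a * e) - φ.eval (e * b * e)) + (φ.eval (e * b * e) - φ₀.eval (e * b * e)) -
      (φ₀.eval (e * a * e) - φ₀.eval (e * b * e)) - (φ₀.eval a - φ₀.eval (e * a * e)) := by ring
  have h6 : 2 * ‖a‖ * δ ≤ r / 4 := by
    have : ‖a‖ ≤ |B| := (hB a ha).trans (le_abs_self B)
    nlinarith
  show ‖φ.eval a - φ₀.eval a‖ ≤ r
  rw [e1]
  refine (norm_sub_le _ _).trans ((add_le_add_left (norm_sub_le _ _) _).trans
    ((add_le_add_left (add_le_add_left norm_add₃_le _) _).trans ?_))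
  linarith

end LipschitzPair

theorem isQuantumLocallyCompact_of_totallyBounded {A : Type*} [NonUnitalCStarAlgebra A]
    [PartialOrder A] [StarOrderedRing A] {P : LipschitzPair A} {h : A}
    (hh : IsStrictlyPositiveElement h) (hB : Bornology.IsBounded P.lipBall)
    (htb : TotallyBounded ((fun a : A => h * a * h) '' P.lipBall)) :
    IsQuantumLocallyCompactSeparableMetricSpace P (NonUnitalStarAlgebra.elemental ℂ h) ∧
      P.mkDiam Set.univ < ⊤ := by
  obtain ⟨B, hB⟩ := hB.exists_norm_le
  refine ⟨⟨⟨hh.isTopography, fun K => LipschitzPair.mkDiam_lt_top hB _, fun S _ => ?_⟩,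
    LipschitzPair.separableSpace hh htb⟩, LipschitzPair.mkDiam_lt_top hB _⟩
  rw [LipschitzPair.mkTopology_eq hh hB htb]

/-! ### Characters of non-unital C*-algebras -/

section Characters

variable {N : Type*} [NonUnitalCStarAlgebra N]

theorem character_star (χ : WeakDual.characterSpace ℂ N) (x : N) : χ (star x) = star (χ x) := by
  have h := map_star (Unitization.lift (WeakDual.CharacterSpace.toNonUnitalAlgHom χ))
    (x : Unitization ℂ N)
  rw [← Unitization.inr_star] at h
  simpa using h

theorem norm_character_le (χ : WeakDual.characterSpace ℂ N) (x : N) : ‖χ x‖ ≤ ‖x‖ := by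
  have h := AlgHom.norm_apply_le_self
    (Unitization.lift (WeakDual.CharacterSpace.toNonUnitalAlgHom χ)) (x : Unitization ℂ N)
  rw [Unitization.norm_inr] at h
  simpa using h

theorem character_cfcₙ (χ : WeakDual.characterSpace ℂ N) {g : ℝ → ℝ} (hg : Continuous g)
    (hg0 : g 0 = 0) {k : N} (hk : IsSelfAdjoint k) : χ (cfcₙ g k) = (g (χ k).re : ℂ) := by
  let F : N →⋆ₙₐ[ℂ] ℂ :=
    { WeakDual.CharacterSpace.toNonUnitalAlgHom χ with map_star' := character_star χ }
  have hF : ∀ x, F x = χ x := fun x => rfl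
  have hFk : IsSelfAdjoint (F k) := by
    rw [IsSelfAdjoint, ← map_star, hk.star_eq]
  have hre : F k = algebraMap ℝ ℂ (F k).re := by
    have := Complex.conj_eq_iff_re.1 hFk.star_eq
    exact this.symm
  have h1 := F.map_cfcₙ g k hg.continuousOn hg0 (map_continuous χ) hk hFk
  rw [← hF, h1, cfcₙ_eq_cfc hg.continuousOn hg0, hre, cfc_algebraMap]
  simp [hF]

/-- A character of the unitization restricts to a character of N or to zero, and the Gel'fand
transform of the unitization is injective. -/
theorem eq_zero_of_forall_character {N : Type*} [NonUnitalCommCStarAlgebra N] {x : N}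
    (hx : ∀ χ : WeakDual.characterSpace ℂ N, χ x = 0) : x = 0 := by
  have h0 : ∀ χ : WeakDual.characterSpace ℂ (Unitization ℂ N), χ (x : Unitization ℂ N) = 0 := by
    intro χ
    let f : WeakDual ℂ N := StrongDual.toWeakDual (WeakDual.CharacterSpace.toCLM χ ∘L
      ({ toLinearMap := Unitization.inrHom ℂ ℂ N, cont := Unitization.continuous_inr } :
        N →L[ℂ] Unitization ℂ N))
    have hf : ∀ y, f y = χ (y : Unitization ℂ N) := fun y => rfl
    by_cases hf0 : f = 0
    · rw [← hf, hf0]; rfl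
    · refine hx ⟨f, hf0, fun y z => ?_⟩
      rw [hf, hf, hf, Unitization.inr_mul, map_mul]
  have h1 : WeakDual.gelfandTransform ℂ (Unitization ℂ N) (x : Unitization ℂ N) =
      WeakDual.gelfandTransform ℂ (Unitization ℂ N) 0 := by
    rw [map_zero]; ext χ; exact h0 χ
  have h2 := (gelfandTransform_isometry (Unitization ℂ N)).injective h1
  exact Unitization.inr_injective (R := ℂ) (by rw [h2, Unitization.inr_zero])

end Characters

/-! ### States on compact sets -/

/-- A set which is compact for a topology inducing on it the topology of an extended
pseudometric has finite nets. -/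
theorem exists_finite_net {X : Type*} (t : TopologicalSpace X) (m : PseudoEMetricSpace X)
    {S : Set X} (hS : @IsCompact X t S)
    (htop : TopologicalSpace.induced ((↑) : S → X) m.toUniformSpace.toTopologicalSpace =
      TopologicalSpace.induced ((↑) : S → X) t)
    {ε : ℝ≥0∞} (hε : 0 < ε) :
    ∃ F : Finset S, ∀ x ∈ S, ∃ y ∈ F, m.edist x y.1 < ε := by
  have hU : ∀ y : S, ∃ U ∈ @nhds X t y.1, ∀ x ∈ S, x ∈ U → m.edist x y.1 < ε := by
    intro y
    have h2 : {x : S | m.edist x.1 y.1 < ε} ∈ comap ((↑) : S → X)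
        (@nhds X m.toUniformSpace.toTopologicalSpace y.1) :=
      preimage_mem_comap (eventually_edist_lt m y.1 hε)
    rw [← @nhds_induced _ _ m.toUniformSpace.toTopologicalSpace ((↑) : S → X) y, htop,
      @nhds_induced _ _ t] at h2
    obtain ⟨U, hU, hsub⟩ := h2
    exact ⟨U, hU, fun x hx hxU => hsub (show (⟨x, hx⟩ : S) ∈ _ from hxU)⟩
  choose U hUn hU using hU
  obtain ⟨F, hF⟩ := @IsCompact.elim_nhds_subcover' X t S hS (fun y hy => U ⟨y, hy⟩)
    fun y hy => hUn ⟨y, hy⟩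
  refine ⟨F, fun x hx => ?_⟩
  obtain ⟨y, hy, hxy⟩ := Set.mem_iUnion₂.1 (hF hx)
  exact ⟨y, hy, hU y x hx hxy⟩

section StatesOn

variable {A : Type*} [NonUnitalCStarAlgebra A] [PartialOrder A] [StarOrderedRing A]
  {M : NonUnitalStarSubalgebra ℂ A} {K : Compacts (Spec M)}

theorem tendsto_indicator_apply (hM : ∀ a ∈ M, ∀ b ∈ M, a * b = b * a) (K : Compacts (Spec M))
    (ψ : StrongDual ℂ (Unitization ℂ A)) :
    Tendsto (fun f : Majorant M K => ψ ((f.1 : A) : Unitization ℂ A)) atBot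
      (𝓝 (indicator M K ψ)) :=
  tendsto_iff_forall_eval_tendsto_topDualPairing.1 (tendsto_indicator M K hM) ψ

/-- φ(1_K) is the limit of a decreasing net of numbers φ(f) ≤ 1, so it equals 1 only if all of them
do. This trades the bidual for elements of M. -/
theorem mem_statesOn_iff (hM : ∀ a ∈ M, ∀ b ∈ M, a * b = b * a) [Nonempty (Majorant M K)]
    (φ : StateSpace A) : φ ∈ statesOn M K ↔ ∀ f : Majorant M K, φ.eval f.1 = 1 := by
  have : IsDirected (Majorant M K) (· ≥ ·) := ⟨fun f g => Majorant.directed M K hM f g⟩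
  have hlim := tendsto_indicator_apply hM K φ.extend
  simp only [StateSpace.extend_inr] at hlim
  constructor
  · intro hφ f
    rw [show indicator M K φ.extend = 1 from hφ] at hlim
    have h0 := φ.eval_nonneg f.2.1
    have h1 : ‖φ.eval f.1‖ ≤ 1 := (φ.norm_eval_le _).trans f.2.2.1
    have h2 : (1 : ℂ) ≤ φ.eval f.1 := by
      refine le_of_tendsto hlim ?_
      filter_upwards [eventually_le_atBot f] with g hg
      exact OrderHomClass.mono φ.toPositive hg
    rw [Complex.eq_coe_norm_of_nonneg h0] at h2 ⊢
    norm_cast at h2 ⊢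
    exact le_antisymm h1 h2
  · intro hφ
    simp only [hφ] at hlim
    exact tendsto_nhds_unique hlim tendsto_const_nhds

/-- Such a state absorbs every majorant on either side, so the nets computing the two products with
1_K are constant. -/
theorem corner_apply_extend (hM : ∀ a ∈ M, ∀ b ∈ M, a * b = b * a) [Nonempty (Majorant M K)]
    {φ : StateSpace A} (hφ : ∀ f : Majorant M K, φ.eval f.1 = 1) (x : Unitization ℂ A) :
    corner M K x φ.extend = φ.extend x := by
  have : IsDirected (Majorant M K) (· ≥ ·) := ⟨fun f g => Majorant.directed M K hM f g⟩
  have h1 : indicator M K ∘L (ContinuousLinearMap.compL ℂ (Unitization ℂ A) (Unitization ℂ A) ℂ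
      φ.extend) ∘L ContinuousLinearMap.mul ℂ (Unitization ℂ A) = φ.extend := by
    ext a
    refine tendsto_nhds_unique (tendsto_indicator_apply hM K _) ?_
    refine tendsto_const_nhds.congr fun f => ?_
    exact (φ.extend_mul_eq f.2.1 f.2.2.1 (hφ f) a).symm
  rw [corner, Bidual.mul_apply, h1, Bidual.mul_apply]
  refine tendsto_nhds_unique (tendsto_indicator_apply hM K _) ?_
  refine tendsto_const_nhds.congr fun f => ?_
  exact (φ.extend_mul_eq' f.2.1 f.2.2.1 (hφ f) x).symm

/-- A majorant of a compact set is a majorant of any smaller compact set. -/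
def Majorant.mono {K' : Compacts (Spec M)} (hK : K ≤ K') (f : Majorant M K') : Majorant M K :=
  ⟨f.1, f.2.1, f.2.2.1, fun χ hχ => f.2.2.2 χ (hK hχ)⟩

/-- The supremum in the definition of tameness is exactly zero as soon as the compact set contains
K. -/
theorem isTame_statesOn (P : LipschitzPair A) (hM : ∀ a ∈ M, ∀ b ∈ M, a * b = b * a)
    (hne : ∀ K : Compacts (Spec M), Nonempty (Majorant M K)) (K : Compacts (Spec M))
    {μ : StateSpace A} (hμ : μ ∈ statesOn M K) : IsTame P M (statesOn M K) := by
  refine ⟨μ, ⟨K, hμ⟩, tendsto_const_nhds.congr' ?_⟩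
  filter_upwards [eventually_ge_atTop K] with K' hK'
  refine (le_antisymm (iSup₂_le fun x _ => iSup₂_le fun φ hφ => ?_) bot_le).symm
  have := hne K
  have := hne K'
  have h1 := (mem_statesOn_iff hM φ).1 hφ
  rw [corner_apply_extend hM (fun f => h1 (f.mono hK')) x, sub_self, enorm_zero]
  exact zero_le

/-- Norm one is not a weak* closed condition in general, but here φ(f) = 1 at a single majorant f
forces it. -/
theorem isCompact_statesOn (hM : ∀ a ∈ M, ∀ b ∈ M, a * b = b * a)
    [hne : Nonempty (Majorant M K)] :
    IsCompact (statesOn M K) := by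
  have hind : Topology.IsInducing (fun φ : StateSpace A => φ.1) := ⟨rfl⟩
  rw [hind.isCompact_iff]
  have himage : (fun φ : StateSpace A => φ.1) '' statesOn M K =
      (WeakDual.toStrongDual ⁻¹' Metric.closedBall (0 : StrongDual ℂ A) 1) ∩
        ({φ : WeakDual ℂ A | ∀ a : A, 0 ≤ a → 0 ≤ φ a} ∩
          {φ : WeakDual ℂ A | ∀ f : Majorant M K, φ f.1 = 1}) := by
    ext φ
    constructor
    · rintro ⟨φ, hφ, rfl⟩
      exact ⟨by simpa using φ.2.2.le, φ.2.1, (mem_statesOn_iff hM φ).1 hφ⟩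
    · rintro ⟨h1, h2, h3⟩
      have h1' : ‖WeakDual.toStrongDual φ‖ ≤ 1 := by simpa using h1
      refine ⟨⟨φ, h2, le_antisymm h1' ?_⟩, (mem_statesOn_iff hM _).2 h3, rfl⟩
      obtain ⟨f⟩ := hne
      have h4 := (WeakDual.toStrongDual φ).le_opNorm f.1
      rw [show WeakDual.toStrongDual φ f.1 = 1 from h3 f, norm_one] at h4
      exact h4.trans (mul_le_of_le_one_right (norm_nonneg _) f.2.2.1)
  rw [himage]
  refine (WeakDual.isCompact_closedBall (0 : StrongDual ℂ A) 1).inter_right (IsClosed.inter ?_ ?_)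
  · simp only [Set.ofPred_forall]
    exact isClosed_iInter fun a => isClosed_iInter fun _ =>
      isClosed_le continuous_const (WeakDual.eval_continuous a)
  · simp only [Set.ofPred_forall]
    exact isClosed_iInter fun f => isClosed_eq (WeakDual.eval_continuous _) continuous_const

omit [StarOrderedRing A] in
theorem exists_finite_net_of_finset {S : Set A} {B : ℝ} (hB : ∀ a ∈ S, ‖a‖ ≤ B)
    {T : Set (StateSpace A)} (F : Finset T) {ε : ℝ} (hε : 0 < ε) :
    ∃ u ⊆ S, u.Finite ∧ ∀ a ∈ S, ∃ b ∈ u, ∀ ψ ∈ F, ‖ψ.1.eval a - ψ.1.eval b‖ < ε := by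
  have htb : TotallyBounded ((fun a : A => fun ψ : F => ψ.1.1.eval a) '' S) := by
    refine (isCompact_closedBall (0 : F → ℂ) (max B 0)).totallyBounded.subset ?_
    rintro _ ⟨a, ha, rfl⟩
    rw [mem_closedBall_zero_iff, pi_norm_le_iff_of_nonneg (le_max_right _ _)]
    exact fun ψ => (ψ.1.1.norm_eval_le a).trans ((hB a ha).trans (le_max_left _ _))
  obtain ⟨u, huS, huf, hu⟩ := totallyBounded_image_iff.1 htb ε hε
  refine ⟨u, huS, huf, fun a ha => ?_⟩
  obtain ⟨b, hb, hab⟩ := hu a ha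
  exact ⟨b, hb, fun ψ hψ => (pi_norm_lt_iff hε).1 hab ⟨ψ, hψ⟩⟩

theorem StateSpace.norm_eval_conj_le (ω : StateSpace A) {e : A} (he : IsSelfAdjoint e) (y : A) :
    ‖ω.eval (e * y * e)‖ ≤ ‖y‖ * (ω.eval (e * e)).re := by
  have h1 := cauchySchwarz ω.toPositive e (y * e)
  simp only [ω.toPositive_apply, he.star_eq] at h1
  have h2 : star (y * e) * (y * e) ≤ ‖y‖ ^ 2 • (e * e) := by
    have h := CStarAlgebra.star_left_conjugate_le_norm_smul (a := e) (b := star y * y)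
    rw [CStarRing.norm_star_mul_self, he.star_eq] at h
    rw [star_mul, he.star_eq, sq]
    calc e * star y * (y * e) = e * (star y * y) * e := by noncomm_ring
      _ ≤ _ := h
  have h3 : (ω.eval (star (y * e) * (y * e))).re ≤ ‖y‖ ^ 2 * (ω.eval (e * e)).re := by
    have h := (Complex.le_def.1 (OrderHomClass.mono ω.toPositive h2)).1
    rw [ω.toPositive_apply, ω.toPositive_apply, ← Complex.coe_smul, ω.eval_smul,
      Complex.re_ofReal_mul] at h
    exact h
  have h4 : 0 ≤ (ω.eval (e * e)).re := by
    have := ω.eval_nonneg (star_mul_self_nonneg e)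
    rw [he.star_eq] at this
    exact (Complex.nonneg_iff.1 this).1
  rw [mul_assoc]
  refine le_of_sq_le_sq (h1.trans ?_) (by positivity)
  rw [mul_pow]
  nlinarith

/-- If every majorant of `K` is a left unit for `e`, then the compression by `e` of a state is a
multiple of a state on `K`. -/
theorem norm_eval_conj_le_of_statesOn (hM : ∀ a ∈ M, ∀ b ∈ M, a * b = b * a)
    [hne : Nonempty (Majorant M K)] {e : A} (he : IsSelfAdjoint e)
    (hfe : ∀ f : Majorant M K, (f.1 : A) * e = e) {y : A} {s : ℝ} (hs : 0 ≤ s)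
    (hy : ∀ ψ ∈ statesOn M K, ‖ψ.eval y‖ ≤ s) (ω : StateSpace A) :
    ‖ω.eval (e * y * e)‖ ≤ ‖e‖ ^ 2 * s := by
  set t := (ω.eval (e * e)).re with ht
  have hωe : 0 ≤ ω.eval (e * e) := by
    have := ω.eval_nonneg (star_mul_self_nonneg e)
    rwa [he.star_eq] at this
  have ht0 : 0 ≤ t := (Complex.nonneg_iff.1 hωe).1
  have htr : ω.eval (e * e) = t :=
    Complex.ext rfl (by rw [Complex.ofReal_im]; exact (Complex.nonneg_iff.1 hωe).2.symm)
  have htle : t ≤ ‖e‖ ^ 2 := by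
    refine (Complex.re_le_norm _).trans ((ω.norm_eval_le _).trans ?_)
    rw [sq]; exact norm_mul_le _ _
  -- For t = 0 the compression cannot be normalized, but Cauchy–Schwarz shows that it vanishes.
  rcases ht0.eq_or_lt with h0 | h0
  · have := ω.norm_eval_conj_le he y
    rw [← ht, ← h0, mul_zero] at this
    exact this.trans (by positivity)
  let g : StrongDual ℂ A := ((t⁻¹ : ℝ) : ℂ) •
    (WeakDual.toStrongDual ω.1 ∘L ContinuousLinearMap.mulLeftRight ℂ A e e)
  have hg : ∀ a, g a = ((t⁻¹ : ℝ) : ℂ) * ω.eval (e * a * e) := fun a => rfl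
  have hgf : ∀ f : Majorant M K, g f.1 = 1 := fun f => by
    rw [hg, mul_assoc, hfe f, htr, ← Complex.ofReal_mul, inv_mul_cancel₀ h0.ne', Complex.ofReal_one]
  obtain ⟨c⟩ := hne
  have hpos : ∀ a, 0 ≤ a → 0 ≤ g a := fun a ha => by
    rw [hg]
    refine mul_nonneg (Complex.zero_le_real.2 (by positivity)) (ω.eval_nonneg ?_)
    exact he.conjugate_nonneg ha
  have hle : ∀ a, ‖g a‖ ≤ ‖a‖ := fun a => by
    rw [hg, norm_mul, Complex.norm_real, Real.norm_of_nonneg (by positivity), inv_mul_le_iff₀ h0,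
      mul_comm]
    exact ω.norm_eval_conj_le he a
  have hc0 : (c.1 : A) ≠ 0 := fun h => by
    have := hgf c
    rw [h, map_zero] at this
    exact zero_ne_one this
  let ψ : StateSpace A := StateSpace.ofBound g hpos hle c.1 hc0 (by
    rw [hgf c, norm_one]; exact c.2.2.1)
  have : Nonempty (Majorant M K) := ⟨c⟩
  have h1 := hy ψ ((mem_statesOn_iff hM ψ).2 hgf)
  have h2 : ω.eval (e * y * e) = t * ψ.eval y := by
    have : ψ.eval y = ((t⁻¹ : ℝ) : ℂ) * ω.eval (e * y * e) := hg y
    rw [this, ← mul_assoc, ← Complex.ofReal_mul, mul_inv_cancel₀ h0.ne', Complex.ofReal_one, one_mul]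
  rw [h2, norm_mul, Complex.norm_real, Real.norm_of_nonneg ht0]
  gcongr

theorem totallyBounded_conj_of_statesOn {P : LipschitzPair A}
    (hM : ∀ a ∈ M, ∀ b ∈ M, a * b = b * a)
    (hne : ∀ K : Compacts (Spec M), Nonempty (Majorant M K))
    (htop : ∀ S : Set (StateSpace A), IsTame P M S →
      TopologicalSpace.induced ((↑) : S → StateSpace A) P.mkTopology =
        TopologicalSpace.induced ((↑) : S → StateSpace A) (StateSpace.instTopologicalSpace A))
    {B : ℝ} (hB : ∀ a ∈ P.lipBall, ‖a‖ ≤ B) {e : A} (he : IsSelfAdjoint e)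
    (hfe : ∀ f : Majorant M K, (f.1 : A) * e = e) :
    TotallyBounded ((fun a : A => e * a * e) '' P.lipBall) := by
  have := hne K
  refine totallyBounded_image_iff.2 fun ε hε => ?_
  -- Elements a, b agree up to 3r on S(A|K): two net errors and one evaluation error. Compression
  -- gives ‖e‖² · 3r < ε.
  set r : ℝ := ε / (4 * (‖e‖ ^ 2 + 1)) with hr
  have hr0 : 0 < r := by positivity
  obtain ⟨F, hF⟩ : ∃ F : Finset (statesOn M K), ∀ φ ∈ statesOn M K, ∃ ψ ∈ F,
      P.mkDist φ ψ.1 < ENNReal.ofReal r := by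
    rcases (statesOn M K).eq_empty_or_nonempty with h0 | ⟨μ, hμ⟩
    · exact ⟨∅, fun φ hφ => by rw [h0] at hφ; exact hφ.elim⟩
    · exact exists_finite_net _ P.mkPseudoEMetricSpace (isCompact_statesOn hM)
        (htop _ (isTame_statesOn P hM hne K hμ)) (by simpa using hr0)
  obtain ⟨u, huS, huf, hu⟩ := exists_finite_net_of_finset hB F hr0
  refine ⟨u, huS, huf, fun a ha => ?_⟩
  obtain ⟨b, hb, hab⟩ := hu a ha
  refine ⟨b, hb, ?_⟩
  have hy : ∀ φ ∈ statesOn M K, ‖φ.eval (a - b)‖ ≤ 3 * r := fun φ hφ => by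
    obtain ⟨ψ, hψF, hψ⟩ := hF φ hφ
    have h1 := LipschitzPair.norm_eval_sub_le_of_mkDist_le hr0.le hψ.le ha
    have h2 := LipschitzPair.norm_eval_sub_le_of_mkDist_le hr0.le hψ.le (huS hb)
    have h3 := hab ψ hψF
    have e1 : φ.eval (a - b) = (φ.eval a - ψ.1.eval a) + (ψ.1.eval a - ψ.1.eval b) -
      (φ.eval b - ψ.1.eval b) := by rw [StateSpace.eval_sub]; ring
    rw [e1]
    refine (norm_sub_le _ _).trans ((add_le_add_left (norm_add_le _ _) _).trans ?_)
    linarith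
  have e2 : e * a * e - e * b * e = e * (a - b) * e := by noncomm_ring
  show ‖e * a * e - e * b * e‖ < ε
  rw [e2]
  by_cases h0 : e * (a - b) * e = 0
  · rw [h0, norm_zero]; exact hε
  have hsa : IsSelfAdjoint (e * (a - b) * e) := by
    have := ((P.isSelfAdjoint_of_mem_lipBall ha).sub
      (P.isSelfAdjoint_of_mem_lipBall (huS hb))).conjugate e
    rwa [he.star_eq] at this
  obtain ⟨ω, hω⟩ := StateSpace.exists_norm_eval_eq hsa h0
  rw [← hω]
  refine (norm_eval_conj_le_of_statesOn hM he hfe (by positivity) hy ω).trans_lt ?_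
  have h5 : r * (4 * (‖e‖ ^ 2 + 1)) = ε := div_mul_cancel₀ _ (by positivity)
  nlinarith [sq_nonneg ‖e‖]

end StatesOn

/-! ### Compact subsets of the spectrum of a strictly positive element -/

section Spectrum

variable {A : Type*} [NonUnitalCStarAlgebra A] [PartialOrder A] [StarOrderedRing A] {h : A}

omit [PartialOrder A] [StarOrderedRing A] in
theorem coe_cfcₙ_elemental (g : ℝ → ℝ) (hg : Continuous g) (hg0 : g 0 = 0)
    {k : NonUnitalStarAlgebra.elemental ℂ h} (hk : IsSelfAdjoint k) :
    ((cfcₙ g k : NonUnitalStarAlgebra.elemental ℂ h) : A) = cfcₙ g (k : A) :=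
  (NonUnitalStarSubalgebraClass.subtype (NonUnitalStarAlgebra.elemental ℂ h)).map_cfcₙ g k
    hg.continuousOn hg0 continuous_subtype_val hk (congrArg Subtype.val hk)

/-- The generator of the C*-algebra generated by `h`. -/
def generator (h : A) : NonUnitalStarAlgebra.elemental ℂ h :=
  ⟨h, NonUnitalStarAlgebra.elemental.self_mem ℂ h⟩

namespace IsStrictlyPositiveElement

variable (hh : IsStrictlyPositiveElement h)
include hh

theorem isSelfAdjoint_generator : IsSelfAdjoint (generator h) := Subtype.ext hh.1.isSelfAdjoint

theorem character_generator_pos (χ : Spec (NonUnitalStarAlgebra.elemental ℂ h)) :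
    0 < (χ (generator h)).re := by
  have hsa := hh.isSelfAdjoint_generator
  -- h = |h| yields χ(h) ≥ 0. If χ(h) were 0, χ would vanish on the dense ideal generated by h,
  -- hence everywhere.
  have habs : cfcₙ (fun t : ℝ => |t|) (generator h) = generator h := by
    apply Subtype.ext
    rw [coe_cfcₙ_elemental _ (by fun_prop) (by simp) hsa]
    conv_rhs => rw [← cfcₙ_id' ℝ ((generator h : NonUnitalStarAlgebra.elemental ℂ h) : A)
      (ha := hh.1.isSelfAdjoint)]
    exact cfcₙ_congr fun t ht => abs_of_nonneg (quasispectrum_nonneg_of_nonneg h hh.1 t ht)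
  have h1 := character_cfcₙ χ (g := fun t : ℝ => |t|) (by fun_prop) (by simp) hsa
  rw [habs] at h1
  have h2 : (χ (generator h)).re = |(χ (generator h)).re| := by
    conv_lhs => rw [h1]
    rw [Complex.ofReal_re]
  refine lt_of_le_of_ne (h2 ▸ abs_nonneg _) fun h0 => ?_
  rw [← h0, abs_zero, Complex.ofReal_zero] at h1
  apply χ.2.1
  refine ContinuousLinearMap.ext fun m => ?_
  have hmem : ∀ n, approxInv h n * m ∈ NonUnitalStarAlgebra.elemental ℂ h := fun n =>
    mul_mem (real_cfcₙ_mem_elemental _ hh.1.isSelfAdjoint) m.2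
  have hlim : Tendsto (fun n => generator h * ⟨approxInv h n * m, hmem n⟩) atTop (𝓝 m) := by
    refine tendsto_subtype_rng.2 ((hh.tendsto_approxUnit_mul (m : A)).congr fun n => ?_)
    rw [approxUnit_eq_mul hh.1.isSelfAdjoint, mul_assoc]
    rfl
  have h3 := ((map_continuous χ).tendsto m).comp hlim
  refine tendsto_nhds_unique h3 (tendsto_const_nhds.congr fun n => ?_)
  rw [Function.comp_apply, map_mul, h1, zero_mul]
  rfl

theorem nonempty_majorant_of_le {K : Compacts (Spec (NonUnitalStarAlgebra.elemental ℂ h))}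
    {r : ℝ} (hr : 0 < r) (hK : ∀ χ ∈ K, r ≤ (χ (generator h)).re) :
    Nonempty (Majorant (NonUnitalStarAlgebra.elemental ℂ h) K) := by
  have hsa := hh.isSelfAdjoint_generator
  have hc : Continuous fun t : ℝ => min (|t| / r) 1 := by fun_prop
  have hz : min (|(0 : ℝ)| / r) 1 = 0 := by simp
  have hcoe := coe_cfcₙ_elemental _ hc hz hsa
  refine ⟨⟨cfcₙ (fun t : ℝ => min (|t| / r) 1) (generator h), ?_, ?_, fun χ hχ => ?_⟩⟩
  · rw [hcoe]
    exact cfcₙ_nonneg fun t _ => by positivity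
  · refine norm_cfcₙ_le fun t _ => ?_
    rw [Real.norm_of_nonneg (by positivity)]
    exact min_le_right _ _
  · rw [character_cfcₙ χ hc hz hsa, min_eq_right, Complex.ofReal_one]
    rw [one_le_div hr]
    exact (hK χ hχ).trans (le_abs_self _)

theorem nonempty_majorant (K : Compacts (Spec (NonUnitalStarAlgebra.elemental ℂ h))) :
    Nonempty (Majorant (NonUnitalStarAlgebra.elemental ℂ h) K) := by
  have hc : Continuous fun χ : Spec (NonUnitalStarAlgebra.elemental ℂ h) =>
      (χ (generator h)).re :=
    Complex.continuous_re.comp ((WeakDual.eval_continuous _).comp continuous_subtype_val)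
  rcases (K : Set (Spec (NonUnitalStarAlgebra.elemental ℂ h))).eq_empty_or_nonempty with h0 | h0
  · exact hh.nonempty_majorant_of_le one_pos fun χ hχ => by
      have : χ ∈ (K : Set (Spec (NonUnitalStarAlgebra.elemental ℂ h))) := hχ
      rw [h0] at this
      exact this.elim
  · obtain ⟨χ₀, -, hmin⟩ := K.isCompact.exists_isMinOn h0 hc.continuousOn
    exact hh.nonempty_majorant_of_le (hh.character_generator_pos χ₀) fun χ hχ => hmin hχ

omit hh [PartialOrder A] [StarOrderedRing A] in
-- The bound by r > 0 keeps the zero functional away, so the set is weak* closed in the dual unit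
-- ball.
theorem isCompact_setOf_le_character {r : ℝ} (hr : 0 < r) :
    IsCompact {χ : Spec (NonUnitalStarAlgebra.elemental ℂ h) | r ≤ (χ (generator h)).re} := by
  have hemb : Topology.IsEmbedding (Subtype.val : Spec (NonUnitalStarAlgebra.elemental ℂ h) →
      WeakDual ℂ (NonUnitalStarAlgebra.elemental ℂ h)) := Topology.IsEmbedding.subtypeVal
  rw [hemb.isCompact_iff]
  have himage : Subtype.val ''
      {χ : Spec (NonUnitalStarAlgebra.elemental ℂ h) | r ≤ (χ (generator h)).re} =
      (WeakDual.toStrongDual ⁻¹'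
        Metric.closedBall (0 : StrongDual ℂ (NonUnitalStarAlgebra.elemental ℂ h)) 1) ∩
        ({φ | ∀ x y, φ (x * y) = φ x * φ y} ∩ {φ | r ≤ (φ (generator h)).re}) := by
    ext φ
    constructor
    · rintro ⟨χ, hχ, rfl⟩
      refine ⟨?_, χ.2.2, hχ⟩
      rw [Set.mem_preimage, mem_closedBall_zero_iff]
      exact ContinuousLinearMap.opNorm_le_bound _ zero_le_one fun x => by
        rw [one_mul]; exact norm_character_le χ x
    · rintro ⟨-, h2, h3⟩
      refine ⟨⟨φ, fun h0 => ?_, h2⟩, h3, rfl⟩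
      rw [h0] at h3
      exact hr.not_ge h3
  rw [himage]
  refine (WeakDual.isCompact_closedBall _ 1).inter_right (IsClosed.inter ?_ ?_)
  · simp only [Set.ofPred_forall]
    exact isClosed_iInter fun x => isClosed_iInter fun y =>
      isClosed_eq (WeakDual.eval_continuous _)
        ((WeakDual.eval_continuous _).mul (WeakDual.eval_continuous _))
  · exact isClosed_le continuous_const (Complex.continuous_re.comp (WeakDual.eval_continuous _))

/-- Checked on characters: f is 1 where χ(h) ≥ r, and (h − r)₊ vanishes elsewhere. -/
theorem majorant_mul_eq {K : Compacts (Spec (NonUnitalStarAlgebra.elemental ℂ h))} {r : ℝ}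
    (hr : 0 < r) (hK : ∀ χ : Spec (NonUnitalStarAlgebra.elemental ℂ h),
      r ≤ (χ (generator h)).re → χ ∈ K)
    (f : Majorant (NonUnitalStarAlgebra.elemental ℂ h) K) :
    (f.1 : A) * cfcₙ (fun t : ℝ => max 0 (t - r)) h = cfcₙ (fun t : ℝ => max 0 (t - r)) h := by
  have hsa := hh.isSelfAdjoint_generator
  have : IsStarNormal h := hh.1.isSelfAdjoint.isStarNormal
  have hc : Continuous fun t : ℝ => max 0 (t - r) := by fun_prop
  have hz : max 0 ((0 : ℝ) - r) = 0 := by simp [hr.le]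
  have hcoe := coe_cfcₙ_elemental _ hc hz hsa
  have key : f.1 * cfcₙ (fun t : ℝ => max 0 (t - r)) (generator h) -
      cfcₙ (fun t : ℝ => max 0 (t - r)) (generator h) = 0 := by
    refine eq_zero_of_forall_character fun χ => ?_
    rw [map_sub, map_mul, character_cfcₙ χ hc hz hsa]
    rcases le_total r (χ (generator h)).re with h1 | h1
    · rw [f.2.2.2 χ (hK χ h1), one_mul, sub_self]
    · rw [max_eq_left (sub_nonpos.2 h1), Complex.ofReal_zero, mul_zero, sub_zero]
  have h2 := congrArg Subtype.val (sub_eq_zero.1 key)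
  rw [hcoe] at h2
  conv_rhs => rw [show h = ((generator h : NonUnitalStarAlgebra.elemental ℂ h) : A) from rfl, ← h2]
  show _ = (f.1 : A) * ((cfcₙ (fun t : ℝ => max 0 (t - r)) (generator h) :
    NonUnitalStarAlgebra.elemental ℂ h) : A)
  rw [hcoe]
  rfl

/-- Compare a state attaining ‖a‖ with one whose value at a is below 1 in modulus. -/
theorem isBounded_lipBall (hA : ¬ IsUnitalAlgebra A) {P : LipschitzPair A}
    (hP : P.mkDiam Set.univ < ⊤) : ∀ a ∈ P.lipBall, ‖a‖ ≤ (P.mkDiam Set.univ).toReal + 1 := by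
  intro a ha
  have hD : 0 ≤ (P.mkDiam Set.univ).toReal := ENNReal.toReal_nonneg
  by_cases h0 : a = 0
  · rw [h0, norm_zero]; positivity
  obtain ⟨φ, hφ⟩ := StateSpace.exists_norm_eval_eq (P.isSelfAdjoint_of_mem_lipBall ha) h0
  obtain ⟨ψ, hψ⟩ := hh.exists_norm_eval_lt hA a one_pos
  have h1 : P.mkDist φ ψ ≤ P.mkDiam Set.univ :=
    (le_iSup₂ (f := fun (ψ : StateSpace A) (_ : ψ ∈ Set.univ) => P.mkDist φ ψ) ψ trivial).trans
      (le_iSup₂ (f := fun (φ : StateSpace A) (_ : φ ∈ Set.univ) =>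
        ⨆ ψ ∈ Set.univ, P.mkDist φ ψ) φ trivial)
  rw [← ENNReal.ofReal_toReal hP.ne] at h1
  have h2 := LipschitzPair.norm_eval_sub_le_of_mkDist_le hD h1 ha
  have h3 := norm_sub_norm_le (φ.eval a) (ψ.eval a)
  rw [hφ] at h3
  linarith

theorem totallyBounded_of_isQuantumLocallyCompact {P : LipschitzPair A}
    (hQ : IsQuantumLocallyCompactMetricSpace P (NonUnitalStarAlgebra.elemental ℂ h))
    {B : ℝ} (hB : ∀ a ∈ P.lipBall, ‖a‖ ≤ B) :
    TotallyBounded ((fun a : A => h * a * h) '' P.lipBall) := by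
  refine totallyBounded_image_of_approx fun δ hδ => ?_
  -- As ‖e − h‖ ≤ r and ‖e‖ ≤ ‖h‖, replacing h by e costs at most 2r|B|‖h‖ ≤ δ.
  set r : ℝ := δ / ((|B| + 1) * (2 * (‖h‖ + 1))) with hrdef
  have hr : 0 < r := by positivity
  have hc : Continuous fun t : ℝ => max 0 (t - r) := by fun_prop
  have hz : max 0 ((0 : ℝ) - r) = 0 := by simp [hr.le]
  set e := cfcₙ (fun t : ℝ => max 0 (t - r)) h with he
  have hesa : IsSelfAdjoint e := cfcₙ_predicate _ _
  have hnorm : ‖e‖ ≤ ‖h‖ := by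
    refine norm_cfcₙ_le fun t ht => ?_
    have h0 : 0 ≤ t := quasispectrum_nonneg_of_nonneg h hh.1 t ht
    have h1 := norm_apply_le_norm_cfcₙ (fun t : ℝ => t) h ht (by fun_prop) rfl hh.1.isSelfAdjoint
    rw [cfcₙ_id' ℝ h hh.1.isSelfAdjoint, Real.norm_of_nonneg h0] at h1
    rw [Real.norm_of_nonneg (le_max_left _ _)]
    exact max_le (norm_nonneg _) (by linarith)
  have hdist : ‖e - h‖ ≤ r := by
    have e1 : e - h = cfcₙ (fun t : ℝ => max 0 (t - r) - t) h := by
      rw [cfcₙ_sub _ (fun t : ℝ => t) h hc.continuousOn hz (by fun_prop) rfl,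
        cfcₙ_id' ℝ h hh.1.isSelfAdjoint]
    rw [e1]
    refine norm_cfcₙ_le fun t ht => ?_
    have h0 : 0 ≤ t := quasispectrum_nonneg_of_nonneg h hh.1 t ht
    rw [Real.norm_eq_abs, abs_le]
    rcases le_total 0 (t - r) with h1 | h1
    · rw [max_eq_right h1]; constructor <;> linarith
    · rw [max_eq_left h1]; constructor <;> linarith
  refine ⟨fun a => e * a * e, ?_, fun a ha => ?_⟩
  · exact totallyBounded_conj_of_statesOn (K := ⟨_, isCompact_setOf_le_character hr⟩)
      hQ.topography.comm hh.nonempty_majorant hQ.topology_eq hB hesa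
      (hh.majorant_mul_eq hr fun χ hχ => hχ)
  · have ha' : ‖a‖ ≤ |B| := (hB a ha).trans (le_abs_self B)
    have e1 : e * a * e - h * a * h = (e - h) * a * e + h * a * (e - h) := by noncomm_ring
    have h1 : ‖(e - h) * a * e‖ ≤ r * |B| * ‖h‖ :=
      (norm_mul_le _ _).trans (mul_le_mul ((norm_mul_le _ _).trans
        (mul_le_mul hdist ha' (norm_nonneg _) hr.le)) hnorm (norm_nonneg _) (by positivity))
    have h2 : ‖h * a * (e - h)‖ ≤ ‖h‖ * |B| * r :=
      (norm_mul_le _ _).trans (mul_le_mul ((norm_mul_le _ _).trans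
        (mul_le_mul_of_nonneg_left ha' (norm_nonneg _))) hdist (norm_nonneg _) (by positivity))
    show ‖e * a * e - h * a * h‖ ≤ δ
    rw [e1]
    refine (norm_add_le _ _).trans ((add_le_add h1 h2).trans ?_)
    have h3 : r * ((|B| + 1) * (2 * (‖h‖ + 1))) = δ := div_mul_cancel₀ _ (by positivity)
    have : 0 ≤ r * |B| := by positivity
    have : 0 ≤ r * ‖h‖ := by positivity
    nlinarith

end IsStrictlyPositiveElement

end Spectrum

end QuantumMetric

end

theorem mainTheorem10 {A : Type*} [NonUnitalCStarAlgebra A] [PartialOrder A] [StarOrderedRing A]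
    (hA : ¬ QuantumMetric.IsUnitalAlgebra A) (P : QuantumMetric.LipschitzPair A) :
    (Bornology.IsBounded P.lipBall ∧
      ∃ h : A, QuantumMetric.IsStrictlyPositiveElement h ∧
        TotallyBounded ((fun a : A => h * a * h) '' P.lipBall)) ↔
    (∃ h : A, QuantumMetric.IsStrictlyPositiveElement h ∧
      QuantumMetric.IsQuantumLocallyCompactSeparableMetricSpace P
        (NonUnitalStarAlgebra.elemental ℂ h) ∧
      P.mkDiam Set.univ < ⊤) := by
  constructor
  · rintro ⟨hB, h, hh, htb⟩
    exact ⟨h, hh, QuantumMetric.isQuantumLocallyCompact_of_totallyBounded hh hB htb⟩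
  · rintro ⟨h, hh, ⟨hQ, -⟩, hD⟩
    have hB := hh.isBounded_lipBall hA hD
    exact ⟨isBounded_iff_forall_norm_le.2 ⟨_, hB⟩, h, hh,
      hh.totallyBounded_of_isQuantumLocallyCompact hQ hB⟩
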